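/- **Setting.** There are $K\ge 1$ arms. Pulling arm $k$ in round $t$ yields a reward $X_{k,t}$ with law $\nu_k$; the reward vectors $(X_{k,t})_{1\le k\le K}$, $t\ge 1$, are independent. Each $\nu_k$ has a finite first moment and is an $(\alpha_k,\beta_k,C_k,C')$-second order Pareto law, i.e. its cdf $F_k$ satisfies $|1-C_kx^{-\alpha_k}-F_k(x)|\le C'x^{-\alpha_k(1+\beta_k)}$ for all $x>0$, where $\alpha_k>1$ and $\beta_k,C_k,C'>0$. There is an arm $k^*$ with $\alpha_{k^*}<\alpha_k$ for all $k\ne k^*$. A number $b$ with $0<b\le\min_k\beta_k$ is known. If a strategy $\pi$ pulls the arms $I_1,\dots,I_n$, its expected extreme regret is $$\mathbb E[R_n]=\max_{1\le k\le K}\mathbb E\Big[\max_{1\le t\le n}X_{k,t}\Big]-\mathbb E\Big[\max_{1\le t\le n}X_{I_t,t}\Big].$$ **Strategies.** For the horizon $n$ put $\rho=2\alpha_{k^*}/(\alpha_{k^*}-1)$, $\delta_0=n^{-\rho}$, $N=\lceil A_0(\log n)^{2(2b+1)/b}\rceil$, $\Lambda_1(T)=D\sqrt{\log(1/\delta_0)}\,T^{-b/(2b+1)}$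 and $\Lambda_2(T)=E\sqrt{\log(T/\delta_0)}\,\log(T)\,T^{-b/(2b+1)}$. From a sample $x_1,\dots,x_T$ compute, for integers $r\ge 0$, $\widehat p_r=\frac1T\#\{i:x_i>e^r\}$ and $\widehat\alpha(r)=\log(\widehat p_r/\widehat p_{r+1})$. Let $\widehat r$ be the smallest $r$ such that $\widehat p_{r+1}>24\log(2/\delta_0)/T$ and $|\widehat\alpha(r')-\widehat\alpha(r)|\le a\sqrt{\log(2/\delta_0)}\,(T\widehat p_{r'+1})^{-1/2}$ for every $r'>r$ with $\widehat p_{r'+1}>24\log(2/\delta_0)/T$ (Lepski's method; $\widehat r=0$ if there is no such $r$). Put $\widetilde h=\min(1/\widehat\alpha(\widehat r),1)$ (with $\widetilde h=1$ if $\widehat\alpha(\widehat r)=0$ or is undefined) and $\widetilde C=T^{-2b/(2b+1)}\,\#\{i:x_i\ge T^{\widetilde h/(2b+1)}\}$. The index of an arm from which this sample has been observed is $$\widetilde\Gamma\big(1-\widetilde h-\Lambda_1(T)\big)\,\big((\widetilde C+\Lambda_2(T))\,n\big)^{\widetilde h+\Lambda_1(T)},$$ where $\widetilde\Gamma(x)=\Gamma(x)$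 for $x>0$ and $\widetilde\Gamma(x)=+\infty$ otherwise. Both strategies first pull each arm $N$ times. Then ExtremeETC pulls one arm of maximal index (computed after these $KN$ rounds) in all remaining rounds, while ExtremeHunter pulls in each remaining round an arm whose current index, computed from all rewards of that arm observed so far, is maximal. Ties are broken arbitrarily. **Theorem 2.** There is a threshold for $a$, and for every $a$ above it there are thresholds for $D$ and $E$, depending only on $a$, $b$, $C'$ and $(\alpha_k,\beta_k,C_k)_{1\le k\le K}$, such that for all larger $D$ and $E$ and all $A_0>0$, for ExtremeETC and for ExtremeHunter, $$\mathbb E[R_n]=\mathcal O\Big((\log n)^{2(2b+1)/b}\,n^{-(1-1/\alpha_{k^*})}+n^{-(b-1/\alpha_{k^*})}\Big)\qquad\text{as }n\to\infty .$$ In particular $\mathbb E[R_n]\to 0$ if $b\ge 1$. Both assertions hold uniformly over all reward laws with the given parameters for which the means of the negative parts of the rewards are at most a given constant (for instance $0$, if the rewards are nonnegative). -/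

import Mathlib

open MeasureTheory ProbabilityTheory Filter Topology Asymptotics
open scoped ENNReal

noncomputable section

namespace ExtremeBandit

/-- `μ` is an `(α, β, C, C')`-second order Pareto law: its cdf `F` satisfies
`|1 - C x^(-α) - F x| ≤ C' x^(-α (1 + β))`. At `x = 0` the right-hand side is infinite, so the
condition only concerns `x > 0`. -/
def IsSecondOrderPareto (α β C C' : ℝ) (μ : Measure ℝ) : Prop :=
  ∀ x : ℝ, 0 < x → |1 - C * x ^ (-α) - cdf μ x| ≤ C' * x ^ (-(α * (1 + β)))

/-- The rewards of a bandit problem with arms `Fin K`: `X k t` is the reward that arm `k` yields in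
round `t` (rounds are numbered from `0`). It has law `ν k`, and the reward vectors of
different rounds are independent. -/
structure IsRewardTable {K : ℕ} {Ω : Type*} [MeasurableSpace Ω] (P : Measure Ω)
    (ν : Fin K → Measure ℝ) (X : Fin K → ℕ → Ω → ℝ) : Prop where
  measurable : ∀ k t, Measurable (X k t)
  law : ∀ k t, P.map (X k t) = ν k
  indep : iIndepFun (fun (t : ℕ) (ω : Ω) (k : Fin K) => X k t ω) P

/-! ### Estimators

A sample is given by a finite set `S` of rounds and the observed values `x s`, `s ∈ S`; its size is
`T = S.card`. -/

/-- The number of observations that exceed `u`. -/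
def exceedances (S : Finset ℕ) (x : ℕ → ℝ) (u : ℝ) : ℕ := {s ∈ S | u < x s}.card

/-- Empirical tail function at `e ^ k`. -/
def tailFreq (S : Finset ℕ) (x : ℕ → ℝ) (k : ℕ) : ℝ :=
  (exceedances S x (Real.exp k) : ℝ) / S.card

/-- The tail index estimator with cut-off `e ^ r`. -/
def alphaAt (S : Finset ℕ) (x : ℕ → ℝ) (r : ℕ) : ℝ :=
  Real.log ((exceedances S x (Real.exp r) : ℝ) / exceedances S x (Real.exp (r + 1)))

/-- The level `24 log (2 / δ) / T` that the empirical tail has to exceed for a cut-off to be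
used at confidence level `δ`. -/
def tailLevel (δ : ℝ) (S : Finset ℕ) : ℝ := 24 * Real.log (2 / δ) / S.card

/-- Lepski's comparison: `r` is acceptable if enough data lie above `e ^ (r + 1)` and the
estimator at `r` agrees, up to the standard deviation of the latter, with the estimator at every
larger cut-off above which there still are enough data. -/
def LepskiOK (a δ : ℝ) (S : Finset ℕ) (x : ℕ → ℝ) (r : ℕ) : Prop :=
  tailLevel δ S < tailFreq S x (r + 1) ∧
    ∀ r' : ℕ, r < r' → tailLevel δ S < tailFreq S x (r' + 1) →
      |alphaAt S x r' - alphaAt S x r| ≤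
        a * √(Real.log (2 / δ)) * √(1 / (S.card * tailFreq S x (r' + 1)))

/-- The adaptive cut-off: the smallest acceptable one (and `0` if there is none). -/
def lepskiCutoff (a δ : ℝ) (S : Finset ℕ) (x : ℕ → ℝ) : ℕ := sInf {r | LepskiOK a δ S x r}

/-- The adaptive tail index estimator. -/
def alphaEst (a δ : ℝ) (S : Finset ℕ) (x : ℕ → ℝ) : ℝ := alphaAt S x (lepskiCutoff a δ S x)

/-- The estimator `min (1 / alphaEst) 1` of `1 / α`, with `1 / 0 = ∞`. -/
def hEst (a δ : ℝ) (S : Finset ℕ) (x : ℕ → ℝ) : ℝ :=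
  if alphaEst a δ S x = 0 then 1 else min (1 / alphaEst a δ S x) 1

/-- The estimator of `C`. -/
def cEst (b a δ : ℝ) (S : Finset ℕ) (x : ℕ → ℝ) : ℝ :=
  (S.card : ℝ) ^ (-(2 * b / (2 * b + 1))) *
    ({s ∈ S | (S.card : ℝ) ^ (hEst a δ S x / (2 * b + 1)) ≤ x s}.card : ℝ)

/-! ### Strategies -/

/-- The parameters of the two strategies. -/
structure Tuning where
  /-- lower bound for the second order exponents -/
  b : ℝ
  /-- exponent of the confidence level `n ^ (-ρ)` -/
  ρ : ℝ
  /-- constant in Lepski's comparison -/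
  a : ℝ
  /-- constant in the length of the exploration phase -/
  A₀ : ℝ
  /-- constant in the width of the confidence interval for `1 / α` -/
  D : ℝ
  /-- constant in the width of the confidence interval for `C` -/
  E : ℝ

namespace Tuning

variable (θ : Tuning) (n : ℕ)

/-- The confidence level. -/
def δ₀ : ℝ := (n : ℝ) ^ (-θ.ρ)

/-- The number of times that every arm is pulled in the exploration phase, rounded up. -/
def N : ℕ := ⌈θ.A₀ * Real.log n ^ (2 * (2 * θ.b + 1) / θ.b)⌉₊

/-- The width of the confidence interval for `1 / α` after `T` observations. -/
def Λ₁ (T : ℕ) : ℝ :=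
  θ.D * √(Real.log (1 / θ.δ₀ n)) * (T : ℝ) ^ (-(θ.b / (2 * θ.b + 1)))

/-- The width of the confidence interval for `C` after `T` observations. -/
def Λ₂ (T : ℕ) : ℝ :=
  θ.E * √(Real.log (T / θ.δ₀ n)) * Real.log T * (T : ℝ) ^ (-(θ.b / (2 * θ.b + 1)))

/-- The optimistic index of an arm from which the sample `(S, x)` has been observed, at horizon
`n`. It is infinite where the argument of the Gamma function is not positive. -/
def index (S : Finset ℕ) (x : ℕ → ℝ) : ℝ≥0∞ :=
  let h := hEst θ.a (θ.δ₀ n) S x + θ.Λ₁ n S.card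
  let c := cEst θ.b θ.a (θ.δ₀ n) S x + θ.Λ₂ n S.card
  if 0 < 1 - h then ENNReal.ofReal (Real.Gamma (1 - h) * (c * n) ^ h) else ⊤

end Tuning

/-- The rounds before round `t` in which arm `k` has been pulled. -/
def pulls {K : ℕ} (I : ℕ → Fin K) (k : Fin K) (t : ℕ) : Finset ℕ := {s ∈ Finset.range t | I s = k}

/-- Arm `k` maximizes, over all arms, the index computed from the rewards
observed in the first `t` rounds. -/
def IsBestIndex {K : ℕ} (θ : Tuning) (n : ℕ) (x : Fin K → ℕ → ℝ) (I : ℕ → Fin K) (t : ℕ)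
    (k : Fin K) : Prop :=
  ∀ j, θ.index n (pulls I j t) (x j) ≤ θ.index n (pulls I k t) (x k)

/-- The exploration phase: each arm is pulled `N` times, one arm after the other. -/
def Explores {K : ℕ} (θ : Tuning) (n : ℕ) (I : ℕ → Fin K) : Prop :=
  ∀ t < n, t < K * θ.N n → (I t : ℕ) = t / θ.N n

/-- The two strategies. -/
inductive Algorithm
  | extremeETC
  | extremeHunter

/-- `I 0, …, I (n - 1)` are the arms pulled by the strategy with horizon `n` if
`x k t` is the reward of arm `k` in round `t`. Ties between indices may be broken in
any way. After the exploration phase `extremeETC` commits to one arm of maximal index, while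
`extremeHunter` pulls in each round an arm of maximal current index. -/
def IsRun {K : ℕ} (alg : Algorithm) (θ : Tuning) (n : ℕ) (x : Fin K → ℕ → ℝ) (I : ℕ → Fin K) :
    Prop :=
  Explores θ n I ∧
    match alg with
    | .extremeETC => ∃ w, IsBestIndex θ n x I (K * θ.N n) w ∧ ∀ t < n, K * θ.N n ≤ t → I t = w
    | .extremeHunter => ∀ t < n, K * θ.N n ≤ t → IsBestIndex θ n x I t (I t)

/-- The expected extreme regret at horizon `n`: the expected maximal reward of the best single
arm, minus the expected maximal reward collected by pulling the arms `I 0, …, I (n - 1)`. -/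
def expectedRegret {K : ℕ} {Ω : Type*} [MeasurableSpace Ω] (P : Measure Ω)
    (X : Fin K → ℕ → Ω → ℝ) (n : ℕ) (I : ℕ → Ω → Fin K) : ℝ :=
  (⨆ k : Fin K, ∫ ω, (⨆ t : Fin n, X k t ω) ∂P) - ∫ ω, (⨆ t : Fin n, X (I t ω) t ω) ∂P

end ExtremeBandit

end

open ExtremeBandit

/-! The regret is small because, with overwhelming probability, both strategies pull `kstar` in
every round after the exploration phase. The exploration phase itself costs only those early rewards
that would exceed the maximum of the remaining rewards of `kstar`.

Statistics. No genuine confidence bounds are needed, only consistency up to a fixed `ε`. Up to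
factors `n ^ ε`, the index of an arm behaves like `n ^ (1 / α)`, and the gap between `1 / α kstar`
and the other `1 / α k` absorbs these factors (`exists_accuracy`, `Tuning.eventually_index_lt`,
`Tuning.eventually_le_index`). The widths `Λ₁`, `Λ₂` only have to be nonnegative, with `Λ₁` small
and `Λ₂` subpolynomial. Consistency is a deterministic consequence of Chernoff bounds for
logarithmically many exceedance counts: `exists_abs_hEst_sub_le` for the Lepski estimator,
`exists_le_cEst` for the estimator of `C`.

Adaptivity. The samples seen by a strategy are random, but if `kstar` always wins they coincide with
deterministic sets of rounds (`sampleSet`). A union bound over these sets, followed by an induction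
over time (`IsRun.eq_kstar`), shows that `kstar` does always win, without any martingale argument.

Regret. Let `M` be the maximum of `kstar` after exploration. On the good event the collected maximum
and that of `kstar` alone both lie between `M` and `M` plus the excesses of early rewards over `M`.
By independence of the rounds, each excess has mean `∫ P(M ≤ x) P(Y > x) dx`, of order `n ^ (-(1 - 1
/ α kstar))` (`HeavyTail.lintegral_sub_sup'_le`), and there are of the order of `N` of them. On the
bad event the maxima are truncated at a power of `n`; `ρ` is large enough to make this negligible.
The result is the first summand of the claimed rate alone. -/

noncomputable section

namespace ExtremeBandit

/-! ### Chernoff bounds for exceedance counts -/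

/-- A count `c` with mean `m` is concentrated at confidence `exp (-L)`. -/
def Concentrated (L m c : ℝ) : Prop :=
  (m ≤ 9 * L → c < 24 * L) ∧ (9 * L ≤ m → |c - m| ≤ 2 * √(m * L))

lemma exceedances_eq_sum {Ω : Type*} (S : Finset ℕ) (Z : ℕ → Ω → ℝ) (u : ℝ) :
    (fun ω => (exceedances S (fun s => Z s ω) u : ℝ)) =
      ∑ s ∈ S, fun ω => (Set.Ioi u).indicator (fun _ => (1 : ℝ)) (Z s ω) := by
  ext ω
  simp [exceedances, Set.indicator_apply]

section Chernoff

variable {Ω : Type*} [MeasurableSpace Ω] {P : Measure Ω} [IsProbabilityMeasure P]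
  {Z : ℕ → Ω → ℝ} {u p : ℝ}

lemma mgf_indicator_Ioi {Y : Ω → ℝ} (hY : Measurable Y) (hp : P.real {ω | u < Y ω} = p) (l : ℝ) :
    mgf (fun ω => (Set.Ioi u).indicator (fun _ => (1 : ℝ)) (Y ω)) P l ≤
      Real.exp (p * (Real.exp l - 1)) := by
  have hms : MeasurableSet {ω | u < Y ω} := measurableSet_lt measurable_const hY
  have h1 : ∀ ω, Real.exp (l * (Set.Ioi u).indicator (fun _ => (1 : ℝ)) (Y ω)) =
      1 + {ω | u < Y ω}.indicator (fun _ => Real.exp l - 1) ω := by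
    intro ω
    by_cases h : u < Y ω
    · rw [Set.indicator_of_mem (by exact h), Set.indicator_of_mem (by exact h)]; simp
    · rw [Set.indicator_of_notMem (by exact h), Set.indicator_of_notMem (by exact h)]; simp
  have h2 : mgf (fun ω => (Set.Ioi u).indicator (fun _ => (1 : ℝ)) (Y ω)) P l =
      1 + p * (Real.exp l - 1) := by
    unfold mgf
    simp_rw [h1]
    rw [integral_add (integrable_const _) ((integrable_const _).indicator hms),
      integral_indicator_const _ hms, hp]
    simp
  rw [h2]
  linarith [Real.add_one_le_exp (p * (Real.exp l - 1))]

/-- A binomial moment generating function is dominated by the Poisson one with the same mean, since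
`1 + y ≤ exp y` in each factor. -/
lemma mgf_count_le (hZ : ∀ s, Measurable (Z s)) (hi : iIndepFun Z P)
    (hp : ∀ s, P.real {ω | u < Z s ω} = p) (S : Finset ℕ) (l : ℝ) :
    mgf (fun ω => (exceedances S (fun s => Z s ω) u : ℝ)) P l ≤
      Real.exp (S.card * p * (Real.exp l - 1)) := by
  have hm : Measurable ((Set.Ioi u).indicator (fun _ : ℝ => (1 : ℝ))) :=
    measurable_const.indicator measurableSet_Ioi
  have hi' : iIndepFun (fun s ω => (Set.Ioi u).indicator (fun _ => (1 : ℝ)) (Z s ω)) P :=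
    hi.comp (fun _ => (Set.Ioi u).indicator (fun _ => (1 : ℝ))) (fun _ => hm)
  rw [exceedances_eq_sum, hi'.mgf_sum (fun s => hm.comp (hZ s))]
  calc _ ≤ ∏ _s ∈ S, Real.exp (p * (Real.exp l - 1)) :=
        Finset.prod_le_prod (fun _ _ => mgf_nonneg) fun s _ => mgf_indicator_Ioi (hZ s) (hp s) l
    _ = _ := by
        rw [Finset.prod_const, ← Real.exp_nat_mul]; ring_nf

lemma measurable_exceedances (hZ : ∀ s, Measurable (Z s)) (S : Finset ℕ) :
    Measurable fun ω => (exceedances S (fun s => Z s ω) u : ℝ) := by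
  rw [exceedances_eq_sum, Finset.sum_fn]
  exact Finset.measurable_sum _ fun s _ =>
    (measurable_const.indicator (f := fun _ : ℝ => (1 : ℝ)) measurableSet_Ioi).comp (hZ s)

lemma integrable_exp_exceedances (hZ : ∀ s, Measurable (Z s)) (S : Finset ℕ) (l : ℝ) :
    Integrable (fun ω => Real.exp (l * (exceedances S (fun s => Z s ω) u : ℝ))) P := by
  refine Integrable.of_bound
    ((measurable_exceedances hZ S).const_mul l).exp.aestronglyMeasurable
    (Real.exp (|l| * S.card)) (.of_forall fun ω => ?_)
  rw [Real.norm_eq_abs, abs_of_pos (Real.exp_pos _), Real.exp_le_exp]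
  have h : (exceedances S (fun s => Z s ω) u : ℝ) ≤ S.card := by
    exact_mod_cast Finset.card_filter_le _ _
  calc l * _ ≤ |l| * (exceedances S (fun s => Z s ω) u : ℝ) :=
        mul_le_mul_of_nonneg_right (le_abs_self l) (by positivity)
    _ ≤ _ := by gcongr

lemma measureReal_count_ge_le (hZ : ∀ s, Measurable (Z s)) (hi : iIndepFun Z P)
    (hp : ∀ s, P.real {ω | u < Z s ω} = p) (S : Finset ℕ) {l : ℝ} (hl : 0 ≤ l) (c : ℝ) :
    P.real {ω | c ≤ exceedances S (fun s => Z s ω) u} ≤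
      Real.exp (-l * c + S.card * p * (Real.exp l - 1)) := by
  rw [Real.exp_add]
  exact (measure_ge_le_exp_mul_mgf c hl (integrable_exp_exceedances hZ S l)).trans
    (mul_le_mul_of_nonneg_left (mgf_count_le hZ hi hp S l) (Real.exp_pos _).le)

lemma measureReal_count_le_le (hZ : ∀ s, Measurable (Z s)) (hi : iIndepFun Z P)
    (hp : ∀ s, P.real {ω | u < Z s ω} = p) (S : Finset ℕ) {l : ℝ} (hl : l ≤ 0) (c : ℝ) :
    P.real {ω | (exceedances S (fun s => Z s ω) u : ℝ) ≤ c} ≤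
      Real.exp (-l * c + S.card * p * (Real.exp l - 1)) := by
  rw [Real.exp_add]
  exact (measure_le_le_exp_mul_mgf c hl (integrable_exp_exceedances hZ S l)).trans
    (mul_le_mul_of_nonneg_left (mgf_count_le hZ hi hp S l) (Real.exp_pos _).le)

lemma exp_sub_one_le_add_sq {l : ℝ} (hl : |l| ≤ 1) : Real.exp l - 1 ≤ l + l ^ 2 := by
  have := Real.abs_exp_sub_one_sub_id_le hl
  linarith [le_abs_self (Real.exp l - 1 - l)]

/-- Chernoff's method. For a small mean take `l = 1`: the exponent is at most `-24 L + 2 * 9 L`. For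
a large mean take `l = √(L / m) ≤ 1`: by `exp l - 1 ≤ l + l ^ 2` the exponent is at most `-2 m l ^ 2
+ m l ^ 2 = -L` on either side. -/
theorem measureReal_not_concentrated_le (hZ : ∀ s, Measurable (Z s)) (hi : iIndepFun Z P)
    (hp : ∀ s, P.real {ω | u < Z s ω} = p) (S : Finset ℕ) {L : ℝ} (hL : 0 < L) :
    P.real {ω | ¬ Concentrated L (S.card * p) (exceedances S (fun s => Z s ω) u)} ≤
      2 * Real.exp (-L) := by
  set m : ℝ := S.card * p with hm
  rcases lt_or_ge m (9 * L) with h | h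
  · have hsub : {ω | ¬ Concentrated L m (exceedances S (fun s => Z s ω) u)} ⊆
        {ω | 24 * L ≤ exceedances S (fun s => Z s ω) u} := by
      intro ω hω
      by_contra hc
      simp only [Set.mem_ofPred_eq, not_le] at hc
      exact hω ⟨fun _ => hc, fun h' => absurd h' (not_le.2 h)⟩
    refine (measureReal_mono hsub).trans
      ((measureReal_count_ge_le hZ hi hp S zero_le_one _).trans ?_)
    have he : Real.exp 1 - 1 ≤ 2 := by linarith [Real.exp_one_lt_d9]
    have hm0 : 0 ≤ m := by
      have := (hp 0).symm ▸ (measureReal_nonneg : 0 ≤ P.real {ω | u < Z 0 ω})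
      positivity
    have : Real.exp (-1 * (24 * L) + m * (Real.exp 1 - 1)) ≤ Real.exp (-L) := by
      rw [Real.exp_le_exp]; nlinarith
    linarith [Real.exp_pos (-L)]
  · have hm0 : 0 < m := by linarith
    set l := √(L / m) with hl
    have hl0 : 0 ≤ l := Real.sqrt_nonneg _
    have hl1 : l ≤ 1 := Real.sqrt_le_one.2 ((div_le_one hm0).2 (by linarith))
    have hlsq : m * l ^ 2 = L := by
      rw [hl, Real.sq_sqrt (by positivity)]; field_simp
    have hml : √(m * L) = m * l := by
      rw [← hlsq, show m * (m * l ^ 2) = (m * l) ^ 2 by ring, Real.sqrt_sq (by positivity)]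
    have hsub : {ω | ¬ Concentrated L m (exceedances S (fun s => Z s ω) u)} ⊆
        {ω | m + 2 * √(m * L) ≤ exceedances S (fun s => Z s ω) u} ∪
        {ω | (exceedances S (fun s => Z s ω) u : ℝ) ≤ m - 2 * √(m * L)} := by
      intro ω hω
      by_contra hc
      simp only [Set.mem_union, Set.mem_ofPred_eq, not_or, not_le] at hc
      refine hω ⟨fun h' => ?_, fun _ => abs_le.2 ⟨by linarith, by linarith⟩⟩
      -- On the boundary both clauses of `Concentrated` apply; the upper deviation bound then keeps
      -- the count below `15 L`.
      have hmL : m = 9 * L := le_antisymm h' h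
      have : √(m * L) = 3 * L := by
        rw [hmL, show 9 * L * L = (3 * L) ^ 2 by ring, Real.sqrt_sq (by positivity)]
      linarith
    refine (measureReal_mono hsub).trans ((measureReal_union_le _ _).trans ?_)
    have hup := measureReal_count_ge_le hZ hi hp S hl0 (m + 2 * √(m * L))
    have hlo := measureReal_count_le_le hZ hi hp S (neg_nonpos.2 hl0) (m - 2 * √(m * L))
    have e1 : -l * (m + 2 * √(m * L)) + m * (Real.exp l - 1) ≤ -L := by
      have := mul_le_mul_of_nonneg_left
        (exp_sub_one_le_add_sq (l := l) (abs_le.2 ⟨by linarith, hl1⟩)) hm0.le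
      rw [hml]; nlinarith
    have e2 : -(-l) * (m - 2 * √(m * L)) + m * (Real.exp (-l) - 1) ≤ -L := by
      have := mul_le_mul_of_nonneg_left
        (exp_sub_one_le_add_sq (l := -l) (abs_le.2 ⟨by linarith, by linarith⟩)) hm0.le
      rw [hml]; nlinarith
    linarith [Real.exp_le_exp.2 e1, Real.exp_le_exp.2 e2]

end Chernoff

/-! ### Bias and stochastic error of the tail index estimator -/

/-- `G` is the tail function of a second order Pareto law, with second order exponent at least
`b`. -/
structure IsParetoTail (α b C C' : ℝ) (G : ℝ → ℝ) : Prop where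
  anti : Antitone G
  approx : ∀ u : ℝ, 1 ≤ u → |G u - C * u ^ (-α)| ≤ C' * u ^ (-(α * (1 + b)))

lemma Concentrated.abs_sub_le {L m c : ℝ} (h : Concentrated L m c) (hL : 0 < L)
    (hm : 9 * L ≤ m) : |c - m| ≤ 2 * √(L / m) * m := by
  have hm0 : 0 < m := by linarith
  have h2 := h.2 hm
  have : √(m * L) = √(L / m) * m := by
    rw [show m * L = L / m * m ^ 2 by field_simp, Real.sqrt_mul (by positivity),
      Real.sqrt_sq hm0.le]
  rw [this] at h2
  linarith

/-- The purpose of the level `9 L`: above it the relative error `2 √(L / m)` is at most `2 / 3`, so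
the count is comparable to its mean and logarithms are Lipschitz. -/
lemma sqrt_div_le_third {L m : ℝ} (hL : 0 < L) (hm : 9 * L ≤ m) : √(L / m) ≤ 1 / 3 := by
  have hm0 : 0 < m := by linarith
  rw [Real.sqrt_le_left (by norm_num), div_le_iff₀ hm0]
  linarith

lemma Concentrated.third_le {L m c : ℝ} (h : Concentrated L m c) (hL : 0 < L)
    (hm : 9 * L ≤ m) : m / 3 ≤ c := by
  have h1 := h.abs_sub_le hL hm
  have h2 := sqrt_div_le_third hL hm
  have hm0 : 0 < m := by linarith
  have := (abs_le.1 h1).1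
  nlinarith

lemma Concentrated.le_two_mul {L m c : ℝ} (h : Concentrated L m c) (hL : 0 < L)
    (hm : 9 * L ≤ m) : c ≤ 2 * m := by
  have h1 := h.abs_sub_le hL hm
  have h2 := sqrt_div_le_third hL hm
  have hm0 : 0 < m := by linarith
  have := (abs_le.1 h1).2
  nlinarith

lemma abs_log_one_add_le {y : ℝ} (hy : |y| ≤ 2 / 3) : |Real.log (1 + y)| ≤ 3 * |y| := by
  obtain ⟨h1, h2⟩ := abs_le.1 hy
  have h0 : 0 < 1 + y := by linarith
  have hu := Real.log_le_sub_one_of_pos h0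
  have hl := Real.one_sub_inv_le_log_of_pos h0
  have hl' : -(3 * |y|) ≤ 1 - (1 + y)⁻¹ := by
    have : 1 - (1 + y)⁻¹ = y / (1 + y) := by field_simp; ring
    rw [this, le_div_iff₀ h0]
    rcases abs_cases y with ⟨e, _⟩ | ⟨e, _⟩ <;> rw [e] <;> nlinarith
  exact abs_le.2 ⟨by linarith, by linarith [le_abs_self y, abs_nonneg y]⟩

lemma Concentrated.abs_log_sub_le {L m c : ℝ} (h : Concentrated L m c) (hL : 0 < L)
    (hm : 9 * L ≤ m) : |Real.log c - Real.log m| ≤ 6 * √(L / m) := by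
  have h1 := h.abs_sub_le hL hm
  have h2 := sqrt_div_le_third hL hm
  have h3 := h.third_le hL hm
  have hm0 : 0 < m := by linarith
  have hc0 : 0 < c := by linarith
  have hy : |(c - m) / m| ≤ 2 * √(L / m) := by
    rw [abs_div, abs_of_pos hm0, div_le_iff₀ hm0]; exact h1
  have := abs_log_one_add_le (hy.trans (by linarith))
  rw [← Real.log_div hc0.ne' hm0.ne', show c / m = 1 + (c - m) / m by field_simp; ring]
  linarith

section

variable {α b C C' : ℝ} {G : ℝ → ℝ}

lemma IsParetoTail.approx_exp (hG : IsParetoTail α b C C' G) {y : ℝ} (hy : 0 ≤ y) :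
    |G (Real.exp y) - C * Real.exp (-α * y)| ≤
      C' * Real.exp (-(α * b) * y) * Real.exp (-α * y) := by
  have h := hG.approx (Real.exp y) (Real.one_le_exp hy)
  rw [← Real.exp_mul, ← Real.exp_mul] at h
  rw [mul_assoc, ← Real.exp_add]
  convert h using 3
  · ring_nf
  · ring_nf

lemma IsParetoTail.half_le (hG : IsParetoTail α b C C' G) {y : ℝ} (hy : 0 ≤ y)
    (hs : C' * Real.exp (-(α * b) * y) ≤ C / 2) :
    C / 2 * Real.exp (-α * y) ≤ G (Real.exp y) := by
  have := (abs_le.1 (hG.approx_exp hy)).1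
  nlinarith [Real.exp_pos (-α * y)]

lemma IsParetoTail.le_two_mul (hG : IsParetoTail α b C C' G) {y : ℝ} (hy : 0 ≤ y)
    (hC : 0 < C) (hs : C' * Real.exp (-(α * b) * y) ≤ C / 2) :
    G (Real.exp y) ≤ 2 * C * Real.exp (-α * y) := by
  have := (abs_le.1 (hG.approx_exp hy)).2
  nlinarith [Real.exp_pos (-α * y), mul_pos hC (Real.exp_pos (-α * y))]

lemma IsParetoTail.abs_log_le (hG : IsParetoTail α b C C' G) {y : ℝ} (hy : 0 ≤ y) (hC : 0 < C)
    (hs : C' * Real.exp (-(α * b) * y) ≤ C / 2) :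
    |Real.log (G (Real.exp y)) - (Real.log C - α * y)| ≤
      3 * (C' / C) * Real.exp (-(α * b) * y) := by
  have h0 := Real.exp_pos (-α * y)
  have h1 := hG.half_le hy hs
  have hg0 : 0 < G (Real.exp y) := lt_of_lt_of_le (by positivity) h1
  set q := C * Real.exp (-α * y) with hq
  have hq0 : 0 < q := by positivity
  have hlq : Real.log C - α * y = Real.log q := by
    rw [hq, Real.log_mul hC.ne' h0.ne', Real.log_exp]; ring
  have hz : |(G (Real.exp y) - q) / q| ≤ (C' / C) * Real.exp (-(α * b) * y) := by
    rw [abs_div, abs_of_pos hq0, div_le_iff₀ hq0]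
    refine (hG.approx_exp hy).trans (le_of_eq ?_)
    rw [hq]; field_simp
  have hz' : (C' / C) * Real.exp (-(α * b) * y) ≤ 2 / 3 := by
    rw [div_mul_eq_mul_div, div_le_iff₀ hC]; linarith
  have := abs_log_one_add_le (hz.trans hz')
  rw [hlq, ← Real.log_div hg0.ne' hq0.ne',
    show G (Real.exp y) / q = 1 + (G (Real.exp y) - q) / q by field_simp; ring]
  linarith

variable {L : ℝ} {S : Finset ℕ} {x : ℕ → ℝ}

lemma exceedances_anti {u v : ℝ} (h : u ≤ v) : exceedances S x v ≤ exceedances S x u :=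
  Finset.card_le_card fun _ hs => by
    simp only [Finset.mem_filter] at hs ⊢
    exact ⟨hs.1, h.trans_lt hs.2⟩

/-- In the difference of the log counts at `r` and `r + 1` the terms `log T` and `log C` cancel and
`α` remains. The two stochastic errors are largest at `r + 1`, where the mean is smaller, and the
two biases at `r`; hence the factors `12 = 6 + 6` and `6 = 3 + 3`. -/
lemma abs_alphaAt_sub_le (hG : IsParetoTail α b C C' G) (hα : 0 < α) (hb : 0 < b) (hC : 0 < C)
    (hC' : 0 < C') (hL : 0 < L) {r : ℕ}
    (h0 : Concentrated L (S.card * G (Real.exp r)) (exceedances S x (Real.exp r)))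
    (h1 : Concentrated L (S.card * G (Real.exp (r + 1))) (exceedances S x (Real.exp (r + 1))))
    (hm : 9 * L ≤ S.card * G (Real.exp (r + 1)))
    (hs : C' * Real.exp (-(α * b) * r) ≤ C / 2) :
    |alphaAt S x r - α| ≤ 12 * √(L / (S.card * G (Real.exp (r + 1)))) +
      6 * (C' / C) * Real.exp (-(α * b) * r) := by
  have hle : Real.exp (-(α * b) * (r + 1 : ℝ)) ≤ Real.exp (-(α * b) * r) := by
    rw [Real.exp_le_exp]; nlinarith [mul_pos hα hb]
  have hs1 : C' * Real.exp (-(α * b) * (r + 1 : ℝ)) ≤ C / 2 :=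
    (mul_le_mul_of_nonneg_left hle hC'.le).trans hs
  have hr : (0 : ℝ) ≤ r := by positivity
  have hr1 : (0 : ℝ) ≤ r + 1 := by positivity
  set m0 := S.card * G (Real.exp r) with hm0
  set m1 := S.card * G (Real.exp (r + 1)) with hm1
  have hmm : m1 ≤ m0 := by
    rw [hm0, hm1]
    exact mul_le_mul_of_nonneg_left (hG.anti (Real.exp_le_exp.2 (by linarith))) (by positivity)
  have hm1p : 0 < m1 := by linarith
  have hm0p : 0 < m0 := by linarith
  have hT : (0 : ℝ) < S.card := by
    rcases (Nat.cast_nonneg (α := ℝ) S.card).eq_or_lt with h | h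
    · rw [hm1, ← h, zero_mul] at hm1p; exact absurd hm1p (lt_irrefl _)
    · exact h
  have hG0 : 0 < G (Real.exp r) := pos_of_mul_pos_right hm0p hT.le
  have hG1 : 0 < G (Real.exp (r + 1)) := pos_of_mul_pos_right hm1p hT.le
  have a0 := h0.abs_log_sub_le hL (hm.trans hmm)
  have a1 := h1.abs_log_sub_le hL hm
  have b0 := hG.abs_log_le hr hC hs
  have b1 := hG.abs_log_le hr1 hC hs1
  have c0 := h0.third_le hL (hm.trans hmm)
  have c1 := h1.third_le hL hm
  have hsq : √(L / m0) ≤ √(L / m1) := Real.sqrt_le_sqrt (by gcongr)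
  have hb1 : 3 * (C' / C) * Real.exp (-(α * b) * (r + 1 : ℝ)) ≤
      3 * (C' / C) * Real.exp (-(α * b) * r) := by gcongr
  rw [alphaAt, Real.log_div (by linarith) (by linarith)]
  rw [hm0, Real.log_mul hT.ne' hG0.ne', ← hm0] at a0
  rw [hm1, Real.log_mul hT.ne' hG1.ne', ← hm1] at a1
  obtain ⟨a01, a02⟩ := abs_le.1 a0
  obtain ⟨a11, a12⟩ := abs_le.1 a1
  obtain ⟨b01, b02⟩ := abs_le.1 b0
  obtain ⟨b11, b12⟩ := abs_le.1 b1
  exact abs_le.2 ⟨by linarith, by linarith⟩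

lemma card_mul_tailFreq (hS : S.card ≠ 0) (k : ℕ) :
    S.card * tailFreq S x k = exceedances S x (Real.exp k) := by
  rw [tailFreq]; field_simp

lemma tailLevel_lt_tailFreq_iff (hS : S.card ≠ 0) {δ : ℝ} (k : ℕ) :
    tailLevel δ S < tailFreq S x k ↔
      24 * Real.log (2 / δ) < exceedances S x (Real.exp k) := by
  have : (0 : ℝ) < S.card := by positivity
  rw [tailLevel, tailFreq, div_lt_div_iff_of_pos_right this]

/-- The cut-off that balances bias and standard deviation. -/
def oracleCutoff (α b T : ℝ) : ℕ := ⌈Real.log T / (α * (2 * b + 1))⌉₊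

/-- The balance at the oracle cut-off: the mean count, of order `T exp (-α r)`, times the squared
relative bias `exp (-2 α b r)` is bounded, so the bias is at most of the order of the standard
deviation. -/
lemma mul_exp_oracleCutoff_le {T : ℝ} (hα : 0 < α) (hb : 0 < b) (hT : 0 < T) :
    T * Real.exp (-(α * (2 * b + 1)) * oracleCutoff α b T) ≤ 1 := by
  have h := Nat.le_ceil (Real.log T / (α * (2 * b + 1)))
  rw [div_le_iff₀ (by positivity)] at h
  calc T * Real.exp (-(α * (2 * b + 1)) * oracleCutoff α b T)
      ≤ T * Real.exp (-Real.log T) := by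
        gcongr; rw [oracleCutoff]; linarith
    _ = 1 := by rw [Real.exp_neg, Real.exp_log hT]; field_simp

lemma exp_oracleCutoff_le_rpow {T : ℝ} (hα : 0 < α) (hb : 0 < b) (hT : 0 < T) :
    Real.exp (-(α * b) * oracleCutoff α b T) * T ^ (b / (2 * b + 1)) ≤ 1 := by
  have h := Nat.le_ceil (Real.log T / (α * (2 * b + 1)))
  rw [div_le_iff₀ (by positivity)] at h
  rw [Real.rpow_def_of_pos hT, ← Real.exp_add, Real.exp_le_one_iff]
  have : Real.log T * (b / (2 * b + 1)) ≤ (α * b) * oracleCutoff α b T := by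
    rw [mul_div_assoc', div_le_iff₀ (by positivity), oracleCutoff]
    nlinarith
  linarith

/-- One factor `exp (-α)` is lost to the ceiling in the cut-off and another to the shift from `r` to
`r + 1`. -/
lemma rpow_sq_le_mul_exp {T : ℝ} (hα : 0 < α) (hb : 0 < b) (hT : 1 ≤ T) :
    Real.exp (-(2 * α)) * (T ^ (b / (2 * b + 1))) ^ 2 ≤
      T * Real.exp (-α * (oracleCutoff α b T + 1)) := by
  have hT0 : 0 < T := by linarith
  have h := Nat.ceil_lt_add_one (a := Real.log T / (α * (2 * b + 1)))
    (by have := Real.log_nonneg hT; positivity)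
  have h2 : α * oracleCutoff α b T ≤ Real.log T / (2 * b + 1) + α := by
    have h3 : α * (Real.log T / (α * (2 * b + 1)) + 1) = Real.log T / (2 * b + 1) + α := by
      field_simp
    rw [oracleCutoff, ← h3]
    exact mul_le_mul_of_nonneg_left h.le hα.le
  nth_rw 2 [← Real.exp_log hT0]
  rw [← Real.rpow_natCast, ← Real.rpow_mul hT0.le, Real.rpow_def_of_pos hT0, ← Real.exp_add,
    ← Real.exp_add, Real.exp_le_exp]
  have h4 : Real.log T * (b / (2 * b + 1) * (2 : ℕ)) = Real.log T - Real.log T / (2 * b + 1) := by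
    push_cast; field_simp; ring
  rw [h4]; linarith

end

/-! ### Lepski's method and consistency of the estimators -/

lemma mul_sqrt_div_le {q ε L m : ℝ} (hq : 0 < q) (hε : 0 < ε) (hm : 0 < m)
    (h : (q / ε) ^ 2 * L ≤ m) : q * √(L / m) ≤ ε := by
  have h1 : √(L / m) ≤ ε / q := by
    rw [Real.sqrt_le_left (by positivity), div_le_iff₀ hm]
    calc L = (ε / q) ^ 2 * ((q / ε) ^ 2 * L) := by field_simp
      _ ≤ _ := by gcongr
  calc q * √(L / m) ≤ q * (ε / q) := by gcongr
    _ = ε := by field_simp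

/-- Since `α > 1`, hardly any observation exceeds `T`. Hence only about `log T` cut-offs matter, and
the union bound over them is cheap. -/
lemma card_mul_tail_ceil_log_le {α b C C' : ℝ} {G : ℝ → ℝ} {T : ℝ} (hG : IsParetoTail α b C C' G)
    (hα : 1 < α) (hb : 0 < b) (hC : 0 < C) (hC' : 0 < C') (hT : 1 ≤ T) :
    T * G (Real.exp ⌈Real.log T⌉₊) ≤ C + C' := by
  have hT0 : 0 < T := by linarith
  set y : ℝ := (⌈Real.log T⌉₊ : ℝ) with hy
  have hy0 : 0 ≤ y := by positivity
  have h1 := (abs_le.1 (hG.approx_exp hy0)).2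
  have h2 : Real.exp (-(α * b) * y) ≤ 1 := by
    rw [Real.exp_le_one_iff]; nlinarith [mul_pos (by linarith : 0 < α) hb]
  have h3 : T * Real.exp (-α * y) ≤ 1 := by
    have := Nat.le_ceil (Real.log T)
    calc T * Real.exp (-α * y) ≤ T * Real.exp (-Real.log T) := by
          gcongr; nlinarith
      _ = 1 := by rw [Real.exp_neg, Real.exp_log hT0]; field_simp
  have h4 : C' * Real.exp (-(α * b) * y) ≤ C' := by nlinarith
  have h5 : G (Real.exp y) ≤ (C + C') * Real.exp (-α * y) := by
    nlinarith [Real.exp_pos (-α * y)]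
  calc T * G (Real.exp y) ≤ T * ((C + C') * Real.exp (-α * y)) := by gcongr
    _ = (C + C') * (T * Real.exp (-α * y)) := by ring
    _ ≤ _ := by nlinarith

/-- Lepski's method attains the accuracy of a cut-off `r₀` beyond which the estimators are dominated
by their standard deviations. -/
lemma abs_alphaEst_sub_le {a α δ L : ℝ} {S : Finset ℕ} {x : ℕ → ℝ} {m : ℕ → ℝ} {r0 R : ℕ}
    (ha : 52 ≤ a) (hL : Real.log (2 / δ) = L) (hL0 : 0 < L) (hS : S.card ≠ 0) (hmanti : Antitone m)
    (hconc : ∀ r ≤ R, Concentrated L (m r) (exceedances S x (Real.exp r)))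
    (hmR : m R ≤ 9 * L) (hm0 : 100 * L ≤ m (r0 + 1))
    (hdev : ∀ r, r0 ≤ r → 9 * L < m (r + 1) → |alphaAt S x r - α| ≤ 13 * √(L / m (r + 1))) :
    |alphaEst a δ S x - α| ≤ (2 * a + 13) * √(L / m (r0 + 1)) := by
  obtain ⟨c, hc⟩ : ∃ c : ℕ → ℝ, ∀ r : ℕ, c r = exceedances S x (Real.exp r) :=
    ⟨_, fun _ => rfl⟩
  have hcanti : Antitone c := fun i j hij => by
    simp only [hc]
    exact_mod_cast exceedances_anti (Real.exp_le_exp.2 (by exact_mod_cast hij))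
  have hconc' : ∀ r ≤ R, Concentrated L (m r) (c r) := fun r hr => by
    rw [hc]; exact hconc r hr
  have hcT : ∀ k, S.card * tailFreq S x k = c k := fun k => by rw [card_mul_tailFreq hS, hc]
  have hlev : ∀ k, tailLevel δ S < tailFreq S x k ↔ 24 * L < c k := fun k => by
    rw [tailLevel_lt_tailFreq_iff hS, hc, hL]
  have hlt : ∀ r, 9 * L < m r → r < R := by
    intro r hr
    by_contra h
    linarith [hmanti (not_lt.1 h)]
  -- Concentration is available only up to `R`. Beyond `R` the counts are at most the one at `R`,
  -- which is below `24 L` because its mean is at most `9 L`.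
  have hgood : ∀ r, 24 * L < c (r + 1) → 9 * L < m (r + 1) := by
    intro r hr
    by_contra h
    push Not at h
    rcases lt_or_ge (r + 1) R with h' | h'
    · exact absurd ((hconc' _ h'.le).1 h) (not_lt.2 hr.le)
    · have := (hconc' _ le_rfl).1 hmR
      linarith [hcanti h']
  have hm9 : 9 * L < m (r0 + 1) := by linarith
  have hconc0 := hconc' (r0 + 1) (hlt _ hm9).le
  have hdev0 := hdev r0 le_rfl hm9
  have hc0 := hconc0.third_le hL0 hm9.le
  have hc24 : 24 * L < c (r0 + 1) := by linarith
  have hok : LepskiOK a δ S x r0 := by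
    refine ⟨(hlev _).2 hc24, fun r' hr' hl => ?_⟩
    have hc' : 24 * L < c (r' + 1) := (hlev _).1 hl
    have hm' := hgood r' hc'
    have hd := hdev r' hr'.le hm'
    have hcm := (hconc' _ (hlt _ hm').le).le_two_mul hL0 hm'.le
    have hm'p : 0 < m (r' + 1) := by linarith
    have hc'p : 0 < c (r' + 1) := by linarith
    have e1 : √(L / m (r0 + 1)) ≤ √(L / m (r' + 1)) := by
      have := hmanti (by omega : r0 + 1 ≤ r' + 1)
      exact Real.sqrt_le_sqrt (by gcongr)
    have e2 : √(L / m (r' + 1)) ≤ 2 * √(L / c (r' + 1)) := by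
      rw [Real.sqrt_le_left (by positivity), mul_pow, Real.sq_sqrt (by positivity),
        mul_div_assoc', div_le_div_iff₀ hm'p hc'p]
      nlinarith
    rw [hcT, hL, mul_assoc, ← Real.sqrt_mul hL0.le, mul_one_div]
    -- `52 = 2 * (13 + 13)`: two deviations, doubled when the unknown mean is replaced by the
    -- observed count.
    have e3 : 52 * √(L / c (r' + 1)) ≤ a * √(L / c (r' + 1)) := by gcongr
    have e4 := abs_sub_le (alphaAt S x r') α (alphaAt S x r0)
    rw [abs_sub_comm α] at e4
    linarith
  have hmem : LepskiOK a δ S x (lepskiCutoff a δ S x) :=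
    Nat.sInf_mem (s := {r | LepskiOK a δ S x r}) ⟨r0, hok⟩
  have hle : lepskiCutoff a δ S x ≤ r0 := Nat.sInf_le hok
  have hs0 : 0 ≤ √(L / m (r0 + 1)) := Real.sqrt_nonneg _
  have ha0 : 0 < a := by linarith
  rw [alphaEst]
  rcases hle.eq_or_lt with h | h
  · rw [h]
    exact hdev0.trans (mul_le_mul_of_nonneg_right (by linarith) hs0)
  -- The selected cut-off is smaller than `r0`, so it passed the comparison with `r0` and inherits
  -- its accuracy, whatever its own bias is.
  · have h1 := hmem.2 r0 h ((hlev _).2 hc24)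
    rw [hcT, hL, mul_assoc, ← Real.sqrt_mul hL0.le, mul_one_div] at h1
    have hmp : 0 < m (r0 + 1) := by linarith
    have hcp : 0 < c (r0 + 1) := by linarith
    have e2 : √(L / c (r0 + 1)) ≤ 2 * √(L / m (r0 + 1)) := by
      rw [Real.sqrt_le_left (by positivity), mul_pow, Real.sq_sqrt (by positivity),
        mul_div_assoc', div_le_div_iff₀ hcp hmp]
      nlinarith
    have h2 : |alphaAt S x r0 - alphaAt S x (lepskiCutoff a δ S x)| ≤ a * (2 * √(L / m (r0 + 1))) :=
      h1.trans (mul_le_mul_of_nonneg_left e2 ha0.le)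
    have e4 := abs_sub_le (alphaAt S x (lepskiCutoff a δ S x)) (alphaAt S x r0) α
    rw [abs_sub_comm] at h2
    linarith

/-- Consistency of the adaptive tail index estimator, for a sample whose exceedance counts
are concentrated. -/
theorem exists_abs_alphaEst_sub_le {α b C C' a ε : ℝ} (hα : 1 < α) (hb : 0 < b) (hC : 0 < C)
    (hC' : 0 < C') (ha : 52 ≤ a) (hε : 0 < ε) :
    ∃ κ : ℝ, 1 ≤ κ ∧ ∀ (δ : ℝ) (S : Finset ℕ) (x : ℕ → ℝ) (G : ℝ → ℝ), IsParetoTail α b C C' G →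
      κ ≤ Real.log (2 / δ) → κ * Real.log (2 / δ) ≤ (S.card : ℝ) ^ (b / (2 * b + 1)) →
      (∀ r ≤ ⌈Real.log S.card⌉₊, Concentrated (Real.log (2 / δ)) (S.card * G (Real.exp r))
        (exceedances S x (Real.exp r))) →
      |alphaEst a δ S x - α| ≤ ε := by
  have hα0 : 0 < α := by linarith
  set K₀ := C / 2 * Real.exp (-(2 * α)) with hK₀
  have hK₀p : 0 < K₀ := by positivity
  set Q := (100 + ((2 * a + 13) / ε) ^ 2) / K₀ with hQ
  have hQp : 0 < Q := by positivity
  -- One summand per requirement: `C + C'` puts the mean at the last level below `9 L`; `2 C' / C`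
  -- makes the relative bias at the oracle cut-off at most `1 / 2`; `72 C' ^ 2 / C`, from `6 ^ 2 *
  -- 2`, makes the bias at most one standard deviation; `Q` leaves enough observations for accuracy
  -- `ε`.
  refine ⟨1 + (C + C') + 2 * C' / C + 72 * (C' ^ 2 / C) + Q, ?_, ?_⟩
  · have : 0 < 2 * C' / C := by positivity
    have : 0 < 72 * (C' ^ 2 / C) := by positivity
    linarith
  intro δ S x G hG hκL hκw hconc
  set κ := 1 + (C + C') + 2 * C' / C + 72 * (C' ^ 2 / C) + Q with hκ
  have p1 : 0 < 2 * C' / C := by positivity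
  have p2 : 0 < 72 * (C' ^ 2 / C) := by positivity
  have k1 : 1 ≤ κ := by linarith
  have k2 : C + C' ≤ κ := by linarith
  have k3 : 2 * C' / C ≤ κ := by linarith
  have k4 : 72 * (C' ^ 2 / C) ≤ κ := by linarith
  have k5 : Q ≤ κ := by linarith
  clear_value κ
  set L := Real.log (2 / δ) with hL
  have hL1 : 1 ≤ L := k1.trans hκL
  have hL0 : 0 < L := by linarith
  set w := (S.card : ℝ) ^ (b / (2 * b + 1)) with hw
  have hκw' : κ ≤ w := (le_mul_of_one_le_right (by linarith) hL1).trans hκw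
  have hw1 : 1 ≤ w := k1.trans hκw'
  have hS : S.card ≠ 0 := by
    intro h
    rw [hw, h, Nat.cast_zero, Real.zero_rpow (by positivity)] at hw1
    linarith
  have hT1 : (1 : ℝ) ≤ S.card := by exact_mod_cast Nat.one_le_iff_ne_zero.2 hS
  have hT0 : (0 : ℝ) < S.card := by linarith
  set T : ℝ := (S.card : ℝ) with hT
  set r0 := oracleCutoff α b T with hr0
  clear_value L w T r0 K₀ Q
  obtain ⟨m, hm⟩ : ∃ m : ℕ → ℝ, ∀ r, m r = T * G (Real.exp r) := ⟨_, fun _ => rfl⟩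
  have hmanti : Antitone m := fun i j hij => by
    rw [hm, hm]
    exact mul_le_mul_of_nonneg_left (hG.anti (Real.exp_le_exp.2 (by exact_mod_cast hij))) hT0.le
  have hexp0 : C' * Real.exp (-(α * b) * r0) ≤ C / 2 := by
    have h1 := exp_oracleCutoff_le_rpow (α := α) (b := b) hα0 hb hT0
    have h2 : 2 * C' / C ≤ w := k3.trans hκw'
    rw [div_le_iff₀ hC] at h2
    have h3 := Real.exp_pos (-(α * b) * r0)
    rw [← hw, ← hr0] at h1
    linarith [mul_le_mul_of_nonneg_right h2 h3.le, mul_le_mul_of_nonneg_left h1 hC.le]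
  have hexp : ∀ r, r0 ≤ r → Real.exp (-(α * b) * r) ≤ Real.exp (-(α * b) * r0) := by
    intro r hr
    have : (r0 : ℝ) ≤ r := by exact_mod_cast hr
    rw [Real.exp_le_exp]; linarith [mul_le_mul_of_nonneg_left this (mul_pos hα0 hb).le]
  -- the oracle cut-off leaves many observations
  have hm0 : 100 * L + ((2 * a + 13) / ε) ^ 2 * L ≤ m (r0 + 1) := by
    have h1 := rpow_sq_le_mul_exp (α := α) (b := b) hα0 hb hT1
    have h2 : C / 2 * Real.exp (-α * ((r0 + 1 : ℕ) : ℝ)) ≤ G (Real.exp ((r0 + 1 : ℕ) : ℝ)) := by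
      refine hG.half_le (by positivity) ?_
      exact (mul_le_mul_of_nonneg_left (hexp _ (Nat.le_succ _)) hC'.le).trans hexp0
    have h3 : K₀ * w ^ 2 ≤ m (r0 + 1) := by
      simp only [hm, hK₀]
      push_cast at h2 ⊢
      have := mul_le_mul_of_nonneg_left h2 hT0.le
      have := mul_le_mul_of_nonneg_left h1 (by positivity : 0 ≤ C / 2)
      rw [← hw, ← hr0] at this
      linarith
    have h4 : Q * L ≤ w ^ 2 := by
      have : Q * L ≤ w := (mul_le_mul_of_nonneg_right k5 hL0.le).trans hκw
      exact this.trans (le_self_pow₀ hw1 two_ne_zero)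
    calc _ = K₀ * (Q * L) := by rw [hQ, ← add_mul]; field_simp
      _ ≤ _ := (mul_le_mul_of_nonneg_left h4 hK₀p.le).trans h3
  have hsqp : 0 ≤ ((2 * a + 13) / ε) ^ 2 := sq_nonneg _
  have hm0' : 100 * L ≤ m (r0 + 1) := by linarith [mul_nonneg hsqp hL0.le]
  have hmR : m ⌈Real.log T⌉₊ ≤ 9 * L := by
    have := card_mul_tail_ceil_log_le hG hα hb hC hC' hT1
    simp only [hm]; linarith
  have hlt : ∀ r, 9 * L < m r → r < ⌈Real.log T⌉₊ := by
    intro r hr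
    by_contra h
    linarith [hmanti (not_lt.1 h)]
  have hbias : ∀ r, r0 ≤ r → 9 * L ≤ m (r + 1) →
      6 * (C' / C) * Real.exp (-(α * b) * r) ≤ √(L / m (r + 1)) := by
    intro r hr hmr
    have hmp : 0 < m (r + 1) := by linarith
    refine Real.le_sqrt_of_sq_le ((le_div_iff₀ hmp).2 ?_)
    have h1 : m (r + 1) ≤ T * (2 * C * Real.exp (-α * r0)) :=
      (hmanti (by omega : r0 ≤ r + 1)).trans
        (by
          rw [hm]
          exact mul_le_mul_of_nonneg_left (hG.le_two_mul (by positivity) hC hexp0) hT0.le)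
    have h2 := mul_exp_oracleCutoff_le (α := α) (b := b) hα0 hb hT0
    rw [← hr0] at h2
    calc (6 * (C' / C) * Real.exp (-(α * b) * r)) ^ 2 * m (r + 1)
        ≤ (6 * (C' / C) * Real.exp (-(α * b) * r0)) ^ 2 * (T * (2 * C * Real.exp (-α * r0))) := by
          have := hexp r hr
          gcongr
      _ = 72 * (C' ^ 2 / C) * (T * Real.exp (-(α * (2 * b + 1)) * r0)) := by
          rw [show -(α * (2 * b + 1)) * (r0 : ℝ) = -(α * b) * r0 + -(α * b) * r0 + -α * r0 by ring,
            Real.exp_add, Real.exp_add]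
          field_simp; ring
      _ ≤ 72 * (C' ^ 2 / C) := mul_le_of_le_one_right p2.le h2
      _ ≤ L := k4.trans hκL
  have hdev : ∀ r, r0 ≤ r → 9 * L < m (r + 1) → |alphaAt S x r - α| ≤ 13 * √(L / m (r + 1)) := by
    intro r hr hmr
    have hlt' := hlt _ hmr
    have h0 := hconc r (by omega)
    have h1 := hconc (r + 1) (by omega)
    have hs : C' * Real.exp (-(α * b) * r) ≤ C / 2 :=
      (mul_le_mul_of_nonneg_left (hexp r hr) hC'.le).trans hexp0
    have hb' := hbias r hr hmr.le
    subst hT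
    simp only [hm] at h0 h1 hb' hmr ⊢
    push_cast at h1 hb' hmr ⊢
    have := abs_alphaAt_sub_le hG hα0 hb hC hC' hL0 h0 h1 hmr.le hs
    linarith
  refine (abs_alphaEst_sub_le ha hL.symm hL0 hS hmanti
    (fun r hr => by rw [hm]; exact hconc r hr) hmR hm0' hdev).trans ?_
  exact mul_sqrt_div_le (by linarith) hε (by linarith) (by linarith)

/-- Consistency of the estimator of `1 / α`. -/
theorem exists_abs_hEst_sub_le {α b C C' a ε : ℝ} (hα : 1 < α) (hb : 0 < b) (hC : 0 < C)
    (hC' : 0 < C') (ha : 52 ≤ a) (hε : 0 < ε) :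
    ∃ κ : ℝ, 1 ≤ κ ∧ ∀ (δ : ℝ) (S : Finset ℕ) (x : ℕ → ℝ) (G : ℝ → ℝ), IsParetoTail α b C C' G →
      κ ≤ Real.log (2 / δ) → κ * Real.log (2 / δ) ≤ (S.card : ℝ) ^ (b / (2 * b + 1)) →
      (∀ r ≤ ⌈Real.log S.card⌉₊, Concentrated (Real.log (2 / δ)) (S.card * G (Real.exp r))
        (exceedances S x (Real.exp r))) →
      |hEst a δ S x - 1 / α| ≤ ε := by
  -- An error of at most `α - 1` keeps the estimator in `[1, ∞)`, where the truncation of its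
  -- reciprocal is inactive and `y ↦ 1 / y` is `1`-Lipschitz.
  obtain ⟨κ, h1, h⟩ := exists_abs_alphaEst_sub_le (a := a) hα hb hC hC' ha
    (lt_min hε (by linarith : 0 < α - 1))
  refine ⟨κ, h1, fun δ S x G hG i1 i2 i3 => ?_⟩
  have h2 := h δ S x G hG i1 i2 i3
  have h3 := (abs_le.1 (h2.trans (min_le_right _ _))).1
  have h4 := h2.trans (min_le_left _ _)
  have h5 : 1 ≤ alphaEst a δ S x := by linarith
  set A := alphaEst a δ S x
  have hA : 0 < A := by linarith
  have hα0 : 0 < α := by linarith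
  rw [hEst, if_neg hA.ne', min_eq_left ((div_le_one hA).2 h5), div_sub_div _ _ hA.ne' hα0.ne',
    abs_div, abs_of_pos (mul_pos hA hα0), div_le_iff₀ (mul_pos hA hα0), one_mul, mul_one,
    abs_sub_comm]
  have : 1 ≤ A * α := by nlinarith
  nlinarith

/-- A lower bound for the estimator of `C`. -/
theorem exists_le_cEst {α b C C' a ε : ℝ} (hα : 1 < α) (hb : 0 < b) (hC : 0 < C)
    (hC' : 0 < C') (hε : 0 < ε) (hεb : α * ε ≤ b) :
    ∃ κ : ℝ, 1 ≤ κ ∧ ∀ (δ : ℝ) (S : Finset ℕ) (x : ℕ → ℝ) (G : ℝ → ℝ), IsParetoTail α b C C' G →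
      κ ≤ Real.log (2 / δ) → κ * Real.log (2 / δ) ≤ (S.card : ℝ) ^ (b / (2 * b + 1)) →
      hEst a δ S x ≤ 1 / α + ε →
      Concentrated (Real.log (2 / δ))
        (S.card * G ((S.card : ℝ) ^ ((1 / α + ε) / (2 * b + 1))))
        (exceedances S x ((S.card : ℝ) ^ ((1 / α + ε) / (2 * b + 1)))) →
      C / 6 * (S.card : ℝ) ^ (-(α * ε)) ≤ cEst b a δ S x := by
  have hα0 : 0 < α := by linarith
  -- `2 C' / C` makes the tail at `v` at least half of its Pareto term; `18 / C` then lifts the mean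
  -- count above `9 L`.
  refine ⟨1 + 2 * C' / C + 18 / C, ?_, ?_⟩
  · have : 0 < 2 * C' / C := by positivity
    have : 0 < 18 / C := by positivity
    linarith
  intro δ S x G hG hκL hκw hh hconc
  have p1 : 0 < 2 * C' / C := by positivity
  have p2 : 0 < 18 / C := by positivity
  set κ := 1 + 2 * C' / C + 18 / C with hκ
  have k1 : 1 ≤ κ := by linarith
  have k2 : 2 * C' / C ≤ κ := by linarith
  have k3 : 18 / C ≤ κ := by linarith
  clear_value κ
  set L := Real.log (2 / δ) with hL
  have hL1 : 1 ≤ L := k1.trans hκL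
  have hL0 : 0 < L := by linarith
  set w := (S.card : ℝ) ^ (b / (2 * b + 1)) with hw
  have hκw' : κ ≤ w := (le_mul_of_one_le_right (by linarith) hL1).trans hκw
  have hw1 : 1 ≤ w := k1.trans hκw'
  have hS : S.card ≠ 0 := by
    intro h
    rw [hw, h, Nat.cast_zero, Real.zero_rpow (by positivity)] at hw1
    linarith
  have hT1 : (1 : ℝ) ≤ S.card := by exact_mod_cast Nat.one_le_iff_ne_zero.2 hS
  have hT0 : (0 : ℝ) < S.card := by linarith
  set T : ℝ := (S.card : ℝ) with hT
  -- The estimator counts above a data-dependent threshold. As `hEst ≤ 1 / α + ε`, that threshold is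
  -- at most the deterministic `v`, to which concentration applies.
  set v := T ^ ((1 / α + ε) / (2 * b + 1)) with hv
  have hb1 : 0 < 2 * b + 1 := by linarith
  have hv1 : 1 ≤ v := Real.one_le_rpow hT1 (by positivity)
  have hvα : v ^ (-α) = T ^ (-((1 + α * ε) / (2 * b + 1))) := by
    rw [hv, ← Real.rpow_mul hT0.le]; congr 1; field_simp
  have hvb : C' * v ^ (-(α * (1 + b))) ≤ C / 2 * v ^ (-α) := by
    have h1 : v ^ (-(α * (1 + b))) = v ^ (-α) * v ^ (-(α * b)) := by
      rw [← Real.rpow_add (by linarith)]; ring_nf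
    have h2 : v ^ (-(α * b)) ≤ w⁻¹ := by
      rw [hv, ← Real.rpow_mul hT0.le, hw, ← Real.rpow_neg hT0.le]
      refine Real.rpow_le_rpow_of_exponent_le hT1 ?_
      have : (1 / α + ε) / (2 * b + 1) * -(α * b) =
          -(b / (2 * b + 1)) - α * b * ε / (2 * b + 1) := by
        field_simp; ring
      rw [this]
      have : 0 < α * b * ε / (2 * b + 1) := by positivity
      linarith
    have h3 : C' * w⁻¹ ≤ C / 2 := by
      have h2 : 2 * C' / C ≤ w := k2.trans hκw'
      rw [div_le_iff₀ hC] at h2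
      rw [← div_eq_mul_inv, div_le_iff₀ (by linarith)]; linarith
    have h4 : 0 < v ^ (-α) := by positivity
    calc _ = v ^ (-α) * (C' * v ^ (-(α * b))) := by rw [h1]; ring
      _ ≤ v ^ (-α) * (C' * w⁻¹) := by gcongr
      _ ≤ v ^ (-α) * (C / 2) := by gcongr
      _ = _ := by ring
  have hGv : C / 2 * v ^ (-α) ≤ G v := by
    have := (abs_le.1 (hG.approx v hv1)).1
    linarith
  have hTv : T * v ^ (-α) = T ^ ((2 * b - α * ε) / (2 * b + 1)) := by
    rw [hvα]
    nth_rw 1 [← Real.rpow_one T]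
    rw [← Real.rpow_add hT0]; congr 1; field_simp; ring
  have hm : 9 * L ≤ T * G v := by
    -- Here `α ε ≤ b` enters: it gives `2 b - α ε ≥ b`.
    have h1 : w ≤ T * v ^ (-α) := by
      rw [hTv, hw]
      refine Real.rpow_le_rpow_of_exponent_le hT1 ?_
      gcongr; linarith
    have h2 : 18 / C * L ≤ w := (mul_le_mul_of_nonneg_right k3 hL0.le).trans hκw
    calc 9 * L = C / 2 * (18 / C * L) := by field_simp; ring
      _ ≤ C / 2 * (T * v ^ (-α)) :=
          mul_le_mul_of_nonneg_left (h2.trans h1) (by positivity)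
      _ = T * (C / 2 * v ^ (-α)) := by ring
      _ ≤ _ := by gcongr
  have hcnt := (show Concentrated L (T * G v) (exceedances S x v) from hconc).third_le hL0 hm
  have hle : (exceedances S x v : ℝ) ≤
      ({s ∈ S | (S.card : ℝ) ^ (hEst a δ S x / (2 * b + 1)) ≤ x s}.card : ℝ) := by
    norm_cast
    refine Finset.card_le_card fun s hs => ?_
    simp only [Finset.mem_filter] at hs ⊢
    refine ⟨hs.1, le_trans ?_ hs.2.le⟩
    rw [hv]
    exact Real.rpow_le_rpow_of_exponent_le hT1 (by gcongr)
  rw [cEst]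
  calc C / 6 * T ^ (-(α * ε))
      ≤ C / 6 * T ^ (-(α * ε) / (2 * b + 1)) := by
        refine mul_le_mul_of_nonneg_left (Real.rpow_le_rpow_of_exponent_le hT1 ?_) (by positivity)
        rw [neg_div, neg_le_neg_iff]
        exact div_le_self (by positivity) (by linarith)
    _ = T ^ (-(2 * b / (2 * b + 1))) * (C / 6 * T ^ ((2 * b - α * ε) / (2 * b + 1))) := by
        rw [mul_left_comm, ← Real.rpow_add hT0]; congr 2; field_simp; ring
    _ = T ^ (-(2 * b / (2 * b + 1))) * (T * (C / 2 * v ^ (-α)) / 3) := by rw [← hTv]; ring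
    _ ≤ T ^ (-(2 * b / (2 * b + 1))) * (T * G v / 3) := by gcongr
    _ ≤ _ := by
        have := hcnt.trans hle
        gcongr

/-! ### Asymptotics of the tuning parameters -/

lemma tendsto_log_natCast : Tendsto (fun n : ℕ => Real.log n) atTop atTop :=
  Real.tendsto_log_atTop.comp tendsto_natCast_atTop_atTop

lemma eventually_log_rpow_le (c p : ℝ) {η : ℝ} (hη : 0 < η) :
    ∀ᶠ n : ℕ in atTop, c * Real.log n ^ p ≤ (n : ℝ) ^ η := by
  have h := ((isLittleO_log_rpow_rpow_atTop p hη).comp_tendsto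
    tendsto_natCast_atTop_atTop).const_mul_left c
  filter_upwards [h.bound one_pos, eventually_ge_atTop 1] with n hn h1
  simp only [Function.comp_apply, Real.norm_eq_abs, one_mul] at hn
  rw [abs_of_nonneg (a := (n : ℝ) ^ η) (by positivity)] at hn
  exact (le_abs_self _).trans hn

lemma eventually_const_mul_rpow_lt (c : ℝ) {p q : ℝ} (h : p < q) :
    ∀ᶠ n : ℕ in atTop, c * (n : ℝ) ^ p < (n : ℝ) ^ q := by
  have h2 := (tendsto_rpow_atTop (sub_pos.2 h)).comp tendsto_natCast_atTop_atTop
  filter_upwards [h2.eventually_gt_atTop c, eventually_ge_atTop 1] with n hn h1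
  have hn0 : (0 : ℝ) < n := by exact_mod_cast h1
  calc c * (n : ℝ) ^ p < (n : ℝ) ^ (q - p) * (n : ℝ) ^ p :=
        mul_lt_mul_of_pos_right hn (by positivity)
    _ = _ := by rw [← Real.rpow_add hn0]; congr 1; ring

namespace Tuning

variable {θ : Tuning}

lemma log_one_div_δ₀ (n : ℕ) : Real.log (1 / θ.δ₀ n) = θ.ρ * Real.log n := by
  rcases Nat.eq_zero_or_pos n with rfl | h
  · by_cases hρ : θ.ρ = 0 <;> simp [δ₀, Real.zero_rpow, hρ]
  · have : (0 : ℝ) < n := by exact_mod_cast h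
    rw [δ₀, one_div, Real.log_inv, Real.log_rpow this]; ring

lemma δ₀_pos {n : ℕ} (hn : 0 < n) : 0 < θ.δ₀ n := by
  have : (0 : ℝ) < n := by exact_mod_cast hn
  rw [δ₀]; positivity

lemma log_two_div_δ₀ {n : ℕ} (hn : 0 < n) :
    Real.log (2 / θ.δ₀ n) = Real.log 2 + θ.ρ * Real.log n := by
  rw [← log_one_div_δ₀, ← Real.log_mul two_ne_zero (one_div_ne_zero (δ₀_pos hn).ne'),
    mul_one_div]

lemma eventually_le_log_two_div_δ₀ (hρ : 0 < θ.ρ) (κ : ℝ) :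
    ∀ᶠ n : ℕ in atTop, κ ≤ Real.log (2 / θ.δ₀ n) := by
  filter_upwards [(tendsto_log_natCast.const_mul_atTop hρ).eventually_ge_atTop κ,
    eventually_gt_atTop 0] with n hn h0
  rw [log_two_div_δ₀ h0]
  linarith [Real.log_nonneg (one_le_two (α := ℝ))]

/-- The exploration phase is long compared with the logarithm of the confidence level. -/
lemma eventually_mul_log_le_rpow (hb : 0 < θ.b) (hA : 0 < θ.A₀) (κ : ℝ) :
    ∀ᶠ n : ℕ in atTop, ∀ T : ℕ, θ.N n ≤ T →
      κ * Real.log (2 / θ.δ₀ n) ≤ (T : ℝ) ^ (θ.b / (2 * θ.b + 1)) := by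
  set β := θ.b / (2 * θ.b + 1) with hβ
  have hβ0 : 0 < β := by positivity
  have hlim : Tendsto (fun n : ℕ => θ.A₀ ^ β * Real.log n - |κ| * |θ.ρ|) atTop atTop :=
    tendsto_atTop_add_const_right _ _ (tendsto_log_natCast.const_mul_atTop (by positivity))
  filter_upwards [hlim.eventually_ge_atTop (|κ| * Real.log 2),
    tendsto_log_natCast.eventually_ge_atTop 1, eventually_gt_atTop 0] with n hn hl h0 T hT
  have hl0 : 0 < Real.log n := by linarith
  have hl2 := Real.log_nonneg (one_le_two (α := ℝ))
  have h1 : θ.A₀ * Real.log n ^ (2 * (2 * θ.b + 1) / θ.b) ≤ T :=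
    (Nat.le_ceil _).trans (by exact_mod_cast hT)
  -- The exponent of the exploration length is such that its power `b / (2 b + 1)` is exactly `log n
  -- ^ 2`, one logarithm more than the confidence level requires.
  have h2 : θ.A₀ ^ β * Real.log n ^ 2 ≤ (T : ℝ) ^ β := by
    calc _ = (θ.A₀ * Real.log n ^ (2 * (2 * θ.b + 1) / θ.b)) ^ β := by
          rw [Real.mul_rpow hA.le (by positivity), ← Real.rpow_mul hl0.le, ← Real.rpow_natCast]
          congr 2
          rw [hβ]; push_cast; field_simp
      _ ≤ _ := by gcongr
  rw [log_two_div_δ₀ h0]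
  calc κ * (Real.log 2 + θ.ρ * Real.log n)
      ≤ |κ| * (Real.log 2 + |θ.ρ| * Real.log n) := by
        refine (le_abs_self _).trans ?_
        rw [abs_mul]
        gcongr
        refine (abs_add_le _ _).trans ?_
        rw [abs_of_nonneg hl2, abs_mul, abs_of_pos hl0]
    _ ≤ |κ| * Real.log 2 * Real.log n + |κ| * |θ.ρ| * Real.log n := by
        nlinarith [mul_nonneg (abs_nonneg κ) hl2]
    _ ≤ θ.A₀ ^ β * Real.log n ^ 2 := by nlinarith
    _ ≤ _ := h2

lemma eventually_N_le_rpow {η : ℝ} (hη : 0 < η) : ∀ᶠ n : ℕ in atTop, (θ.N n : ℝ) ≤ (n : ℝ) ^ η := by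
  filter_upwards [eventually_log_rpow_le (2 * |θ.A₀|) (2 * (2 * θ.b + 1) / θ.b) hη,
    (eventually_const_mul_rpow_lt 2 hη), eventually_ge_atTop 1] with n h1 h2 h3
  have hl : 0 ≤ Real.log n := Real.log_nonneg (by exact_mod_cast h3)
  have hp : 0 ≤ Real.log n ^ (2 * (2 * θ.b + 1) / θ.b) := by positivity
  rw [Real.rpow_zero, mul_one] at h2
  have h4 : (θ.N n : ℝ) ≤ |θ.A₀| * Real.log n ^ (2 * (2 * θ.b + 1) / θ.b) + 1 := by
    have := Nat.ceil_lt_add_one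
      (mul_nonneg (abs_nonneg θ.A₀) hp)
    refine le_trans ?_ this.le
    rw [N]
    exact_mod_cast Nat.ceil_mono (mul_le_mul_of_nonneg_right (le_abs_self _) hp)
  linarith

lemma eventually_Λ₁_le (hb : 0 < θ.b) (hA : 0 < θ.A₀) (hρ : 0 < θ.ρ) (hD : 0 ≤ θ.D)
    {ε : ℝ} (hε : 0 < ε) :
    ∀ᶠ n : ℕ in atTop, ∀ T : ℕ, θ.N n ≤ T → θ.Λ₁ n T ≤ ε := by
  filter_upwards [eventually_mul_log_le_rpow hb hA (θ.D / ε), eventually_mul_log_le_rpow hb hA 1,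
    eventually_le_log_two_div_δ₀ hρ 1, eventually_gt_atTop 0] with n h1 h2 h3 h0 T hT
  have k1 := h1 T hT
  have k2 := h2 T hT
  rw [one_mul] at k2
  set L := Real.log (2 / θ.δ₀ n) with hL
  have hle : Real.log (1 / θ.δ₀ n) ≤ L := by
    rw [hL, log_two_div_δ₀ h0, log_one_div_δ₀]
    linarith [Real.log_nonneg (one_le_two (α := ℝ))]
  have hs : √(Real.log (1 / θ.δ₀ n)) ≤ L := by
    rw [Real.sqrt_le_left (by linarith)]; nlinarith
  have hw : 0 < (T : ℝ) ^ (θ.b / (2 * θ.b + 1)) := by linarith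
  rw [Λ₁, Real.rpow_neg (by positivity), ← div_eq_mul_inv, div_le_iff₀ hw]
  rw [div_mul_eq_mul_div, div_le_iff₀ hε] at k1
  calc _ ≤ θ.D * L := by gcongr
    _ ≤ _ := by linarith

lemma Λ₁_nonneg (hD : 0 ≤ θ.D) (n T : ℕ) : 0 ≤ θ.Λ₁ n T := by
  rw [Λ₁]; positivity

lemma Λ₂_nonneg (hE : 0 ≤ θ.E) (n T : ℕ) : 0 ≤ θ.Λ₂ n T := by
  have := Real.log_natCast_nonneg T
  rw [Λ₂]; positivity

end Tuning

lemma cEst_nonneg (b a δ : ℝ) (S : Finset ℕ) (x : ℕ → ℝ) : 0 ≤ cEst b a δ S x := by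
  rw [cEst]; positivity

/-- Crude, but enough for the inferior arms: their samples keep the polylogarithmic size `N`, and a
factor `n ^ η` does no harm in the comparison of indices. -/
lemma cEst_le_card {b : ℝ} (hb : 0 < b) (a δ : ℝ) (S : Finset ℕ) (x : ℕ → ℝ) :
    cEst b a δ S x ≤ S.card := by
  rcases Nat.eq_zero_or_pos S.card with h | h
  · rw [Finset.card_eq_zero] at h; simp [cEst, h]
  · have h1 : (1 : ℝ) ≤ S.card := by exact_mod_cast h
    have h2 : (S.card : ℝ) ^ (-(2 * b / (2 * b + 1))) ≤ 1 :=
      Real.rpow_le_one_of_one_le_of_nonpos h1 (neg_nonpos.2 (by positivity))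
    rw [cEst]
    refine (mul_le_mul h2 (Nat.cast_le.2 (Finset.card_filter_le _ _)) (by positivity)
      zero_le_one).trans (one_mul _).le

lemma Tuning.eventually_cEst_add_Λ₂_le {θ : Tuning} (hb : 0 < θ.b) (hρ : 0 < θ.ρ) (hE : 0 ≤ θ.E)
    {η : ℝ} (hη : 0 < η) :
    ∀ᶠ n : ℕ in atTop, ∀ (S : Finset ℕ) (x : ℕ → ℝ), S.card = θ.N n →
      cEst θ.b θ.a (θ.δ₀ n) S x + θ.Λ₂ n S.card ≤ (n : ℝ) ^ η := by
  filter_upwards [eventually_N_le_rpow (θ := θ) (by positivity : 0 < η / 4),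
    eventually_log_rpow_le 1 1 (by positivity : 0 < η / 4),
    eventually_const_mul_rpow_lt (1 + θ.E * (2 + θ.ρ)) (by linarith : η / 2 < η),
    eventually_ge_atTop 1] with n h1 h2 h3 h0 S x hS
  have hn1 : (1 : ℝ) ≤ n := by exact_mod_cast h0
  have hn0 : (0 : ℝ) < n := by linarith
  rw [Real.rpow_one, one_mul] at h2
  set z := (n : ℝ) ^ (η / 4) with hz
  have hz2 : (n : ℝ) ^ (η / 2) = z ^ 2 := by
    rw [hz, ← Real.rpow_natCast, ← Real.rpow_mul hn0.le]; congr 1; push_cast; ring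
  have hz1 : 1 ≤ z := Real.one_le_rpow hn1 (by positivity)
  have hl : 0 ≤ Real.log n := Real.log_nonneg hn1
  rw [← hS] at h1
  have hc : cEst θ.b θ.a (θ.δ₀ n) S x ≤ z ^ 2 := by
    refine (cEst_le_card hb _ _ _ _).trans (h1.trans (le_self_pow₀ hz1 two_ne_zero))
  have hΛ : θ.Λ₂ n S.card ≤ θ.E * (2 + θ.ρ) * z ^ 2 := by
    rcases Nat.eq_zero_or_pos S.card with h | h
    · simp only [Λ₂, h, Nat.cast_zero, Real.log_zero, mul_zero, zero_mul]; positivity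
    · have hT : (1 : ℝ) ≤ S.card := by exact_mod_cast h
      have hT0 : (0 : ℝ) < S.card := by linarith
      have hlT : Real.log S.card ≤ z := (Real.log_le_self hT0.le).trans h1
      have hlT0 : 0 ≤ Real.log S.card := Real.log_nonneg hT
      have hs : √(Real.log (S.card / θ.δ₀ n)) ≤ (2 + θ.ρ) * z := by
        have h4 : Real.log (S.card / θ.δ₀ n) ≤ (1 + θ.ρ) * z := by
          rw [← mul_one_div, Real.log_mul hT0.ne' (one_div_ne_zero (δ₀_pos h0).ne'),
            log_one_div_δ₀]
          nlinarith
        rw [Real.sqrt_le_left (by positivity)]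
        refine h4.trans ?_
        have h5 : (1 + θ.ρ) * z ≤ (2 + θ.ρ) * z := by nlinarith
        have h6 : 1 ≤ (2 + θ.ρ) * z := by nlinarith
        nlinarith
      have hp : (S.card : ℝ) ^ (-(θ.b / (2 * θ.b + 1))) ≤ 1 :=
        Real.rpow_le_one_of_one_le_of_nonpos hT (neg_nonpos.2 (by positivity))
      calc θ.Λ₂ n S.card ≤ θ.E * ((2 + θ.ρ) * z) * z * 1 := by rw [Λ₂]; gcongr
        _ = _ := by ring
  rw [hz2] at h3
  linarith

/-! ### Polynomial bounds for the indices -/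

lemma one_le_Gamma {y : ℝ} (h0 : 0 < y) (h1 : y ≤ 1) : 1 ≤ Real.Gamma y := by
  rw [← Real.Gamma_one]
  exact Real.Gamma_strictAntiOn_Ioc.antitoneOn ⟨h0, h1⟩ ⟨one_pos, le_rfl⟩ h1

/-- The index of an arm with few observations is at most of the order of its own expected
maximum, up to a small power of the horizon. -/
theorem Tuning.eventually_index_lt {θ : Tuning} (hb : 0 < θ.b) (hρ : 0 < θ.ρ) (hA : 0 < θ.A₀)
    (hD : 0 ≤ θ.D) (hE : 0 ≤ θ.E) {h g ε : ℝ} (hε : 0 < ε) (hεh : ε < h) (h1 : h + 2 * ε < 1)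
    (hg : (1 + ε) * (h + 2 * ε) < g) :
    ∀ᶠ n : ℕ in atTop, ∀ (S : Finset ℕ) (x : ℕ → ℝ), S.card = θ.N n →
      |hEst θ.a (θ.δ₀ n) S x - h| ≤ ε → θ.index n S x < ENNReal.ofReal ((n : ℝ) ^ g) := by
  filter_upwards [eventually_cEst_add_Λ₂_le hb hρ hE hε, eventually_Λ₁_le hb hA hρ hD hε,
    eventually_const_mul_rpow_lt (Real.Gamma (1 - h - 2 * ε)) hg,
    eventually_ge_atTop 1] with n i1 i2 i3 i0 S x hS hh
  have hn1 : (1 : ℝ) ≤ n := by exact_mod_cast i0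
  have hn0 : (0 : ℝ) < n := by linarith
  have j1 := i1 S x hS
  have j2 := i2 S.card hS.ge
  have j3 := Λ₁_nonneg hD n S.card
  have j4 := Λ₂_nonneg hE n S.card
  have j5 := cEst_nonneg θ.b θ.a (θ.δ₀ n) S x
  obtain ⟨l1, l2⟩ := abs_le.1 hh
  simp only [index]
  set h' := hEst θ.a (θ.δ₀ n) S x + θ.Λ₁ n S.card
  set c' := cEst θ.b θ.a (θ.δ₀ n) S x + θ.Λ₂ n S.card
  have hh' : h' ≤ h + 2 * ε := by simp only [h']; linarith
  have hh0 : 0 < h' := by simp only [h']; linarith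
  have hc0 : 0 ≤ c' := by positivity
  rw [if_pos (by linarith), ENNReal.ofReal_lt_ofReal_iff (by positivity)]
  refine lt_of_le_of_lt ?_ i3
  have hG : Real.Gamma (1 - h') ≤ Real.Gamma (1 - h - 2 * ε) :=
    Real.Gamma_strictAntiOn_Ioc.antitoneOn ⟨by linarith, by linarith⟩
      ⟨by linarith, by linarith⟩ (by linarith)
  have hcn : c' * n ≤ (n : ℝ) ^ (1 + ε) := by
    rw [add_comm, Real.rpow_add_one hn0.ne']; gcongr
  have hp : (c' * n) ^ h' ≤ (n : ℝ) ^ ((1 + ε) * (h + 2 * ε)) := by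
    calc (c' * n) ^ h' ≤ ((n : ℝ) ^ (1 + ε)) ^ h' := by gcongr
      _ ≤ ((n : ℝ) ^ (1 + ε)) ^ (h + 2 * ε) :=
        Real.rpow_le_rpow_of_exponent_le (Real.one_le_rpow hn1 (by linarith)) hh'
      _ = _ := by rw [← Real.rpow_mul hn0.le]
  exact mul_le_mul hG hp (by positivity) (Real.Gamma_nonneg_of_nonneg (by linarith))

/-- The index of an arm is at least of the order of its expected maximum, up to a small power of
the horizon. -/
theorem Tuning.eventually_le_index {θ : Tuning} (hb : 0 < θ.b) (hρ : 0 < θ.ρ) (hA : 0 < θ.A₀)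
    (hD : 0 ≤ θ.D) (hE : 0 ≤ θ.E) {C α h g ε : ℝ} (hC : 0 < C) (hα : 0 < α) (hε : 0 < ε)
    (hεh : ε < h) (hαε : α * ε < 1) (hg : g < (1 - α * ε) * (h - ε)) :
    ∀ᶠ n : ℕ in atTop, ∀ (S : Finset ℕ) (x : ℕ → ℝ), θ.N n ≤ S.card → S.card ≤ n →
      |hEst θ.a (θ.δ₀ n) S x - h| ≤ ε →
      C * (S.card : ℝ) ^ (-(α * ε)) ≤ cEst θ.b θ.a (θ.δ₀ n) S x →
      ENNReal.ofReal ((n : ℝ) ^ g) ≤ θ.index n S x := by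
  filter_upwards [eventually_const_mul_rpow_lt (C⁻¹ ^ (h - ε)) hg,
    eventually_const_mul_rpow_lt C⁻¹ (by linarith : 0 < 1 - α * ε),
    eventually_mul_log_le_rpow hb hA 1, eventually_le_log_two_div_δ₀ hρ 1,
    eventually_ge_atTop 1] with n i1 i2 i4 i5 i0 S x hN hn hh hc
  have hn1 : (1 : ℝ) ≤ n := by exact_mod_cast i0
  have hn0 : (0 : ℝ) < n := by linarith
  have j3 := Λ₁_nonneg hD n S.card
  have j4 := Λ₂_nonneg hE n S.card
  obtain ⟨l1, l2⟩ := abs_le.1 hh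
  simp only [index]
  set h' := hEst θ.a (θ.δ₀ n) S x + θ.Λ₁ n S.card
  set c' := cEst θ.b θ.a (θ.δ₀ n) S x + θ.Λ₂ n S.card
  have hh' : h - ε ≤ h' := by simp only [h']; linarith
  -- An infinite index satisfies the lower bound trivially.
  split_ifs with hlt
  swap
  · exact le_top
  refine ENNReal.ofReal_le_ofReal ?_
  have hG : 1 ≤ Real.Gamma (1 - h') := one_le_Gamma hlt (by linarith)
  have hT : (0 : ℝ) < S.card := by
    rw [Nat.cast_pos, Nat.pos_iff_ne_zero]
    intro h0
    have := i4 _ hN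
    rw [h0, Nat.cast_zero, Real.zero_rpow (by positivity)] at this
    linarith
  have hcn : C * (n : ℝ) ^ (1 - α * ε) ≤ c' * n := by
    have h3 : (n : ℝ) ^ (-(α * ε)) ≤ (S.card : ℝ) ^ (-(α * ε)) :=
      Real.rpow_le_rpow_of_nonpos hT (by exact_mod_cast hn) (neg_nonpos.2 (by positivity))
    calc C * (n : ℝ) ^ (1 - α * ε) = C * (n : ℝ) ^ (-(α * ε)) * n := by
          rw [show 1 - α * ε = -(α * ε) + 1 by ring, Real.rpow_add_one hn0.ne']; ring
      _ ≤ C * (S.card : ℝ) ^ (-(α * ε)) * n := by gcongr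
      _ ≤ c' * n := by
          have : C * (S.card : ℝ) ^ (-(α * ε)) ≤ c' := by simp only [c']; linarith
          gcongr
  have hz1 : 1 ≤ C * (n : ℝ) ^ (1 - α * ε) := by
    rw [Real.rpow_zero, mul_one, inv_lt_iff_one_lt_mul₀ hC] at i2
    linarith
  calc (n : ℝ) ^ g ≤ (C * (n : ℝ) ^ (1 - α * ε)) ^ (h - ε) := by
        rw [Real.mul_rpow hC.le (by positivity), ← Real.rpow_mul hn0.le]
        rw [Real.inv_rpow hC.le, inv_mul_lt_iff₀ (by positivity)] at i1
        exact i1.le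
    _ ≤ (C * (n : ℝ) ^ (1 - α * ε)) ^ h' := Real.rpow_le_rpow_of_exponent_le hz1 hh'
    _ ≤ (c' * n) ^ h' := Real.rpow_le_rpow (by linarith) hcn (by linarith)
    _ ≤ Real.Gamma (1 - h') * (c' * n) ^ h' :=
      le_mul_of_one_le_left (Real.rpow_nonneg (by linarith) _) hG

/-! ### Maxima of independent heavy-tailed samples -/

lemma measure_sup'_le_le {Ω : Type*} [MeasurableSpace Ω] {P : Measure Ω} {Z : ℕ → Ω → ℝ}
    {S : Finset ℕ} (hi : iIndepFun Z P) (hS : S.Nonempty) (x : ℝ) :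
    P {ω | S.sup' hS (fun s => Z s ω) ≤ x} = ∏ s ∈ S, P {ω | Z s ω ≤ x} := by
  refine Eq.trans (congrArg P ?_) (hi.measure_inter_preimage_eq_mul S
    (sets := fun _ => Set.Iic x) (fun _ _ => measurableSet_Iic))
  ext ω
  simp [Finset.sup'_le_iff]

/-- `Z` has a tail of order at least `x ^ (-α)`. -/
def HeavyTail {Ω : Type*} [MeasurableSpace Ω] (P : Measure Ω) (Z : ℕ → Ω → ℝ) (x₀ c α : ℝ) : Prop :=
  ∀ s, ∀ x, x₀ ≤ x → P {ω | Z s ω ≤ x} ≤ ENNReal.ofReal (Real.exp (-(c * x ^ (-α))))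

lemma HeavyTail.measure_sup'_le {Ω : Type*} [MeasurableSpace Ω] {P : Measure Ω}
    {Z : ℕ → Ω → ℝ} {S : Finset ℕ} {x₀ c α : ℝ} (h : HeavyTail P Z x₀ c α) (hi : iIndepFun Z P)
    (hS : S.Nonempty) {x : ℝ} (hx : x₀ ≤ x) :
    P {ω | S.sup' hS (fun s => Z s ω) ≤ x} ≤
      ENNReal.ofReal (Real.exp (-(c * S.card * x ^ (-α)))) := by
  rw [measure_sup'_le_le hi hS]
  refine (Finset.prod_le_prod' fun s _ => h s x hx).trans ?_
  rw [Finset.prod_const, ← ENNReal.ofReal_pow (Real.exp_pos _).le, ← Real.exp_nat_mul]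
  refine ENNReal.ofReal_le_ofReal (Real.exp_le_exp.2 (le_of_eq ?_))
  ring

section LayerCake

variable {Ω : Type*} [MeasurableSpace Ω] {P : Measure Ω} [IsProbabilityMeasure P]

/-- Layer cake formula for the positive part of a difference. -/
lemma lintegral_ofReal_sub_eq {Y M : Ω → ℝ} (hY : Measurable Y) (hM : Measurable M) :
    ∫⁻ ω, ENNReal.ofReal (Y ω - M ω) ∂P = ∫⁻ x : ℝ, P {ω | M ω ≤ x ∧ x < Y ω} := by
  have hA : MeasurableSet {p : Ω × ℝ | M p.1 ≤ p.2 ∧ p.2 < Y p.1} :=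
    (measurableSet_le (hM.comp measurable_fst) measurable_snd).inter
      (measurableSet_lt measurable_snd (hY.comp measurable_fst))
  have h1 := Measure.prod_apply (μ := P) (ν := volume) hA
  have h2 := Measure.prod_apply_symm (μ := P) (ν := volume) hA
  rw [h1] at h2
  rw [show (fun x : ℝ => P {ω | M ω ≤ x ∧ x < Y ω}) = fun x =>
    P ((fun ω => (ω, x)) ⁻¹' {p : Ω × ℝ | M p.1 ≤ p.2 ∧ p.2 < Y p.1}) from rfl, ← h2]
  refine lintegral_congr fun ω => ?_
  rw [← Real.volume_Ico]
  rfl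

lemma lintegral_Ioi_rpow {c α u : ℝ} (hc : 0 ≤ c) (hα : 1 < α) (hu : 0 < u) :
    ∫⁻ x in Set.Ioi u, ENNReal.ofReal (c * x ^ (-α)) =
      ENNReal.ofReal (c / (α - 1) * u ^ (1 - α)) := by
  rw [← ofReal_integral_eq_lintegral_ofReal]
  · rw [integral_const_mul, integral_Ioi_rpow_of_lt (by linarith) hu]
    congr 1
    rw [show -α + 1 = 1 - α by ring, show (1 - α) = -(α - 1) by ring]
    have : α - 1 ≠ 0 := by linarith
    field_simp
  · exact (integrableOn_Ioi_rpow_of_lt (by linarith) hu).const_mul c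
  · filter_upwards [ae_restrict_mem measurableSet_Ioi] with x hx
    have : 0 < x := hu.trans hx
    simp only [Pi.zero_apply]
    positivity

/-- Mean excess over a high level. -/
lemma lintegral_ofReal_sub_const_le {Y : Ω → ℝ} (hY : Measurable Y) {c α u : ℝ} (hc : 0 ≤ c)
    (hα : 1 < α) (hu : 1 ≤ u)
    (htail : ∀ x, 1 ≤ x → P {ω | x < Y ω} ≤ ENNReal.ofReal (c * x ^ (-α))) :
    ∫⁻ ω, ENNReal.ofReal (Y ω - u) ∂P ≤ ENNReal.ofReal (c / (α - 1) * u ^ (1 - α)) := by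
  rw [lintegral_ofReal_sub_eq hY measurable_const, ← lintegral_Ioi_rpow hc hα (by linarith),
    ← lintegral_indicator measurableSet_Ioi]
  refine lintegral_mono_ae ?_
  have : ∀ᵐ x : ℝ, x ≠ u := by simp [ae_iff]
  filter_upwards [this] with x hx
  rcases lt_or_gt_of_ne hx with h | h
  · rw [show {ω | u ≤ x ∧ x < Y ω} = ∅ by ext ω; simp [h]]; simp
  · rw [Set.indicator_of_mem (by exact h)]
    exact (measure_mono fun ω hω => hω.2).trans (htail x (by linarith))

section Max

variable {Z : ℕ → Ω → ℝ} {S : Finset ℕ}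

lemma measurable_sup'_apply (hm : ∀ s, Measurable (Z s)) (hS : S.Nonempty) :
    Measurable fun ω => S.sup' hS (fun s => Z s ω) := by
  have := Finset.measurable_sup' hS (fun s _ => hm s)
  convert this using 1
  ext ω; rw [Finset.sup'_apply]

/-- All observations but one contribute a factor `q`, which makes the bound exponentially small;
hence `card - 1`. The remaining one keeps its own distribution function, whose integral over `x <
x₀` is finite by the bound on negative parts. -/
lemma HeavyTail.lintegral_const_sub_le {x₀ c α B : ℝ} (h : HeavyTail P Z x₀ c α)
    (hi : iIndepFun Z P) (hm : ∀ s, Measurable (Z s)) (hx₀ : 0 ≤ x₀)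
    (hneg : ∀ s, ∫⁻ ω, ENNReal.ofReal (-Z s ω) ∂P ≤ ENNReal.ofReal B) (hS : S.Nonempty) :
    ∫⁻ ω, ENNReal.ofReal (x₀ - S.sup' hS (fun s => Z s ω)) ∂P ≤
      ENNReal.ofReal ((x₀ + |B|) * Real.exp (-(c * x₀ ^ (-α) * (S.card - 1 : ℕ)))) := by
  have hMm := measurable_sup'_apply hm hS
  obtain ⟨s₀, hs₀⟩ := id hS
  set q := ENNReal.ofReal (Real.exp (-(c * x₀ ^ (-α)))) with hq
  have hle : ∀ x, P {ω | S.sup' hS (fun s => Z s ω) ≤ x ∧ x < x₀} ≤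
      q ^ (S.card - 1) * P {ω | Z s₀ ω ≤ x ∧ x < x₀} := by
    intro x
    rcases lt_or_ge x x₀ with hx | hx
    · simp only [hx, and_true]
      rw [measure_sup'_le_le hi hS, ← Finset.mul_prod_erase _ _ hs₀, mul_comm]
      gcongr
      refine (Finset.prod_le_prod' fun s _ => ?_ : _ ≤ ∏ _s ∈ S.erase s₀, q).trans ?_
      · exact (measure_mono fun ω (hω : Z s ω ≤ x) => hω.trans hx.le).trans (h s x₀ le_rfl)
      · rw [Finset.prod_const, Finset.card_erase_of_mem hs₀]
    · simp [not_lt.2 hx]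
  rw [lintegral_ofReal_sub_eq measurable_const hMm]
  refine (lintegral_mono hle).trans ?_
  rw [lintegral_const_mul' _ _ (ENNReal.pow_ne_top ENNReal.ofReal_ne_top),
    ← lintegral_ofReal_sub_eq measurable_const (hm s₀), mul_comm,
    ENNReal.ofReal_mul (by positivity)]
  gcongr
  · calc ∫⁻ ω, ENNReal.ofReal (x₀ - Z s₀ ω) ∂P
        ≤ ∫⁻ ω, (ENNReal.ofReal x₀ + ENNReal.ofReal (-Z s₀ ω)) ∂P :=
          lintegral_mono fun ω => by rw [sub_eq_add_neg]; exact ENNReal.ofReal_add_le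
      _ ≤ ENNReal.ofReal x₀ + ENNReal.ofReal |B| := by
          rw [lintegral_add_left measurable_const]
          simp only [lintegral_const, measure_univ, mul_one]
          gcongr
          exact (hneg s₀).trans (ENNReal.ofReal_le_ofReal (le_abs_self B))
      _ = _ := (ENNReal.ofReal_add hx₀ (abs_nonneg B)).symm
  · rw [← ENNReal.ofReal_pow (Real.exp_pos _).le, ← Real.exp_nat_mul]
    refine ENNReal.ofReal_le_ofReal (Real.exp_le_exp.2 (le_of_eq ?_))
    ring

/-- A further observation with a tail of the same order rarely exceeds the maximum of a large
sample, and then not by much. -/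
lemma HeavyTail.lintegral_sub_sup'_le {x₀ c α B c₂ : ℝ} {Y : Ω → ℝ} (h : HeavyTail P Z x₀ c α)
    (hi : iIndepFun Z P) (hm : ∀ s, Measurable (Z s)) (hY : Measurable Y) (hx₀ : 1 ≤ x₀)
    (hc : 0 < c) (hα : 1 < α) (hc₂ : 0 ≤ c₂)
    (hneg : ∀ s, ∫⁻ ω, ENNReal.ofReal (-Z s ω) ∂P ≤ ENNReal.ofReal B) (hS : S.Nonempty)
    (hind : ∀ x, P {ω | S.sup' hS (fun s => Z s ω) ≤ x ∧ x < Y ω} ≤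
      P {ω | S.sup' hS (fun s => Z s ω) ≤ x} * P {ω | x < Y ω})
    (htail : ∀ x, 1 ≤ x → P {ω | x < Y ω} ≤ ENNReal.ofReal (c₂ * x ^ (-α))) :
    ∫⁻ ω, ENNReal.ofReal (Y ω - S.sup' hS (fun s => Z s ω)) ∂P ≤
      ENNReal.ofReal ((x₀ + |B|) * Real.exp (-(c * x₀ ^ (-α) * (S.card - 1 : ℕ))) +
        (c₂ / c + c₂ / (α - 1)) * (S.card : ℝ) ^ (-(1 - 1 / α))) := by
  have hMm := measurable_sup'_apply hm hS
  have hα0 : 0 < α := by linarith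
  have hT : (0 : ℝ) < S.card := by exact_mod_cast hS.card_pos
  set M := fun ω => S.sup' hS (fun s => Z s ω) with hM
  set T : ℝ := (S.card : ℝ) with hTdef
  -- `u` is the typical size of the maximum. On `[x₀, u]` the inequality `y exp (-y) ≤ 1` with `y =
  -- c T x ^ (-α)` bounds the product of the probabilities by `c₂ / (c T)`; above `u` the tail of
  -- `Y` alone is integrated. Both pieces are of order `T ^ (1 / α - 1)`.
  set u := T ^ (1 / α) with hu
  have hu0 : 0 < u := by positivity
  have hpt : ∀ x, P {ω | M ω ≤ x ∧ x < Y ω} ≤ P {ω | M ω ≤ x ∧ x < x₀} +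
      ((Set.Ioc 0 u).indicator (fun _ => ENNReal.ofReal (c₂ / (c * T))) x +
        (Set.Ioi u).indicator (fun x => ENNReal.ofReal (c₂ * x ^ (-α))) x) := by
    intro x
    rcases lt_or_ge x x₀ with hx | hx
    · refine le_add_right (measure_mono fun ω hω => ⟨hω.1, hx⟩)
    · refine le_add_left ?_
      have hx0 : 0 < x := by linarith
      have h1 := htail x (hx₀.trans hx)
      refine (hind x).trans ?_
      rcases le_or_gt x u with hxu | hxu
      · refine le_add_right ?_
        rw [Set.indicator_of_mem (show x ∈ Set.Ioc 0 u from ⟨hx0, hxu⟩)]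
        refine (mul_le_mul' (h.measure_sup'_le hi hS hx) h1).trans ?_
        rw [← ENNReal.ofReal_mul (Real.exp_pos _).le]
        refine ENNReal.ofReal_le_ofReal ?_
        rw [← hTdef, le_div_iff₀ (by positivity), Real.exp_neg, inv_mul_eq_div, div_mul_eq_mul_div,
          div_le_iff₀ (Real.exp_pos _)]
        have h2 := Real.add_one_le_exp (c * T * x ^ (-α))
        nlinarith
      · refine le_add_left ?_
        rw [Set.indicator_of_mem (by exact hxu)]
        exact (mul_le_mul' prob_le_one h1).trans (one_mul _).le
  rw [lintegral_ofReal_sub_eq hY hMm]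
  refine (lintegral_mono fun x => (hpt x).trans (add_assoc _ _ _).ge).trans ?_
  have hmeas : Measurable ((Set.Ioc 0 u).indicator (fun _ : ℝ => ENNReal.ofReal (c₂ / (c * T)))) :=
    measurable_const.indicator measurableSet_Ioc
  have hmeas2 : Measurable ((Set.Ioi u).indicator (fun x : ℝ => ENNReal.ofReal (c₂ * x ^ (-α)))) :=
    Measurable.indicator (by fun_prop) measurableSet_Ioi
  have he : ∀ e : ℝ, 1 / α + e = -(1 - 1 / α) → u * T ^ e = T ^ (-(1 - 1 / α)) := fun e he => by
    rw [hu, ← Real.rpow_add hT, he]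
  rw [lintegral_add_right _ hmeas2, lintegral_add_right _ hmeas, add_assoc,
    lintegral_indicator measurableSet_Ioc, lintegral_indicator measurableSet_Ioi,
    lintegral_Ioi_rpow hc₂ hα hu0, ← lintegral_ofReal_sub_eq measurable_const hMm,
    setLIntegral_const, Real.volume_Ioc, sub_zero, ← ENNReal.ofReal_mul (by positivity),
    ← ENNReal.ofReal_add (by positivity)
      (mul_nonneg (div_nonneg hc₂ (by linarith)) (by positivity)),
    ENNReal.ofReal_add (by positivity)
      (mul_nonneg (add_nonneg (by positivity) (div_nonneg hc₂ (by linarith))) (by positivity))]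
  refine add_le_add (h.lintegral_const_sub_le hi hm (by linarith) hneg hS)
    (ENNReal.ofReal_le_ofReal (le_of_eq ?_))
  have e1 : c₂ / (c * T) * u = c₂ / c * T ^ (-(1 - 1 / α)) := by
    rw [← he (-1) (by ring), Real.rpow_neg_one]; field_simp
  have e2 : u ^ (1 - α) = T ^ (-(1 - 1 / α)) := by
    rw [hu, ← Real.rpow_mul hT.le]; congr 1; field_simp; ring
  rw [e1, e2]; ring

/-- The maximum of a large sample is rarely small. -/
lemma HeavyTail.lintegral_rpow_sub_sup'_le {x₀ c α B : ℝ} (h : HeavyTail P Z x₀ c α)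
    (hi : iIndepFun Z P) (hm : ∀ s, Measurable (Z s)) (hx₀ : 1 ≤ x₀) (hc : 0 < c) (hα : 1 < α)
    (hneg : ∀ s, ∫⁻ ω, ENNReal.ofReal (-Z s ω) ∂P ≤ ENNReal.ofReal B) (hS : S.Nonempty) :
    ∫⁻ ω, ENNReal.ofReal ((S.card : ℝ) ^ (1 / α) - S.sup' hS (fun s => Z s ω)) ∂P ≤
      ENNReal.ofReal ((x₀ + |B|) + Real.exp (-c) * (S.card : ℝ) ^ (1 / α)) := by
  have hMm := measurable_sup'_apply hm hS
  have hα0 : 0 < α := by linarith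
  have hT : (0 : ℝ) < S.card := by exact_mod_cast hS.card_pos
  set M := fun ω => S.sup' hS (fun s => Z s ω) with hM
  set T : ℝ := (S.card : ℝ) with hTdef
  -- For `x₀ ≤ x < u` the exponent `c T x ^ (-α)` is at least `c`. The factor `exp (-c) < 1` leaves
  -- a positive multiple of `u` for the expected maximum.
  set u := T ^ (1 / α) with hu
  have hu0 : 0 < u := by positivity
  have hpt : ∀ x, P {ω | M ω ≤ x ∧ x < u} ≤ P {ω | M ω ≤ x ∧ x < x₀} +
      (Set.Ioc 0 u).indicator (fun _ => ENNReal.ofReal (Real.exp (-c))) x := by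
    intro x
    rcases lt_or_ge x x₀ with hx | hx
    · refine le_add_right (measure_mono fun ω hω => ⟨hω.1, hx⟩)
    · refine le_add_left ?_
      have hx0 : 0 < x := by linarith
      rcases lt_or_ge x u with hxu | hxu
      · rw [Set.indicator_of_mem (show x ∈ Set.Ioc 0 u from ⟨hx0, hxu.le⟩)]
        refine (measure_mono fun ω hω => hω.1).trans ((h.measure_sup'_le hi hS hx).trans ?_)
        refine ENNReal.ofReal_le_ofReal (Real.exp_le_exp.2 (neg_le_neg ?_))
        have h1 : u ^ (-α) ≤ x ^ (-α) := Real.rpow_le_rpow_of_nonpos hx0 hxu.le (by linarith)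
        have h2 : T * u ^ (-α) = 1 := by
          rw [hu, ← Real.rpow_mul hT.le, show 1 / α * -α = -1 by field_simp, Real.rpow_neg_one]
          field_simp
        calc c = c * (T * u ^ (-α)) := by rw [h2, mul_one]
          _ ≤ c * (T * x ^ (-α)) := by gcongr
          _ = _ := by ring
      · simp [not_lt.2 hxu]
  rw [lintegral_ofReal_sub_eq measurable_const hMm]
  refine (lintegral_mono hpt).trans ?_
  have hmeas : Measurable ((Set.Ioc 0 u).indicator
      (fun _ : ℝ => ENNReal.ofReal (Real.exp (-c)))) :=
    measurable_const.indicator measurableSet_Ioc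
  rw [lintegral_add_right _ hmeas, lintegral_indicator measurableSet_Ioc,
    ← lintegral_ofReal_sub_eq measurable_const hMm,
    setLIntegral_const, Real.volume_Ioc, sub_zero, ← ENNReal.ofReal_mul (by positivity),
    ENNReal.ofReal_add (by positivity) (by positivity)]
  gcongr
  refine (h.lintegral_const_sub_le hi hm (by linarith) hneg hS).trans
    (ENNReal.ofReal_le_ofReal (mul_le_of_le_one_right (by positivity) ?_))
  rw [Real.exp_le_one_iff, neg_nonpos]
  positivity

end Max

end LayerCake

lemma integral_le_of_lintegral_ofReal_le
    {Ω : Type*} [MeasurableSpace Ω] {P : Measure Ω}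
    {f : Ω → ℝ} (hf : Integrable f P) {c : ℝ} (hc : 0 ≤ c)
    (h : ∫⁻ ω, ENNReal.ofReal (f ω) ∂P ≤ ENNReal.ofReal c) : ∫ ω, f ω ∂P ≤ c := by
  rw [integral_eq_lintegral_pos_part_sub_lintegral_neg_part hf]
  have := ENNReal.toReal_mono ENNReal.ofReal_ne_top h
  rw [ENNReal.toReal_ofReal hc] at this
  linarith [ENNReal.toReal_nonneg (a := ∫⁻ ω, ENNReal.ofReal (-f ω) ∂P)]

/-! ### Pareto laws and reward tables -/

/-- Lowering the second order exponent to the known `b` enlarges the error term only for `u ≥ 1`,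
which is why `IsParetoTail` is restricted to that range. -/
lemma IsSecondOrderPareto.isParetoTail {α β b C C' : ℝ} {μ : Measure ℝ}
    (h : IsSecondOrderPareto α β C C' μ) (hα : 0 < α) (hC' : 0 < C') (hb : b ≤ β) :
    IsParetoTail α b C C' fun u => 1 - cdf μ u where
  anti := fun _ _ hxy => sub_le_sub_left (monotone_cdf μ hxy) 1
  approx := fun u hu => by
    have h1 := h u (by linarith)
    rw [abs_sub_comm] at h1
    rw [abs_sub_comm, show C * u ^ (-α) - (1 - cdf μ u) = cdf μ u - (1 - C * u ^ (-α)) by ring]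
    refine h1.trans (mul_le_mul_of_nonneg_left ?_ hC'.le)
    exact Real.rpow_le_rpow_of_exponent_le hu (by nlinarith)

lemma IsParetoTail.le_rpow {α b C C' : ℝ} {G : ℝ → ℝ} (hG : IsParetoTail α b C C' G) (hα : 0 < α)
    (hb : 0 < b) (hC' : 0 < C') {x : ℝ} (hx : 1 ≤ x) : G x ≤ (C + C') * x ^ (-α) := by
  have h1 := (abs_le.1 (hG.approx x hx)).2
  have h2 : x ^ (-(α * (1 + b))) ≤ x ^ (-α) :=
    Real.rpow_le_rpow_of_exponent_le hx (by nlinarith [mul_pos hα hb])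
  nlinarith

lemma IsParetoTail.exists_le {α b C C' : ℝ} (hα : 0 < α) (hb : 0 < b) (hC : 0 < C) (hC' : 0 < C') :
    ∃ x₀ : ℝ, 1 ≤ x₀ ∧ ∀ G : ℝ → ℝ, IsParetoTail α b C C' G →
      ∀ x, x₀ ≤ x → C / 2 * x ^ (-α) ≤ G x := by
  refine ⟨max 1 ((2 * C' / C) ^ (1 / (α * b))), le_max_left _ _, fun G hG x hx => ?_⟩
  have hx1 : 1 ≤ x := (le_max_left _ _).trans hx
  have hx2 : (2 * C' / C) ^ (1 / (α * b)) ≤ x := (le_max_right _ _).trans hx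
  have hx0 : 0 < x := by linarith
  have h1 := (abs_le.1 (hG.approx x hx1)).1
  have h2 : 2 * C' / C ≤ x ^ (α * b) := by
    calc 2 * C' / C = ((2 * C' / C) ^ (1 / (α * b))) ^ (α * b) := by
          rw [← Real.rpow_mul (by positivity), one_div_mul_cancel (by positivity), Real.rpow_one]
      _ ≤ _ := by gcongr
  have h3 : x ^ (-(α * (1 + b))) = x ^ (-α) * (x ^ (α * b))⁻¹ := by
    rw [← Real.rpow_neg hx0.le, ← Real.rpow_add hx0]; congr 1; ring
  have hp : 0 < x ^ (α * b) := by positivity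
  have h4 : C' * (x ^ (α * b))⁻¹ ≤ C / 2 := by
    rw [← div_eq_mul_inv, div_le_iff₀ hp]
    rw [div_le_iff₀ hC] at h2
    linarith
  have h5 : 0 < x ^ (-α) := by positivity
  rw [h3] at h1
  nlinarith

namespace IsRewardTable

variable {K : ℕ} {Ω : Type*} [MeasurableSpace Ω] {P : Measure Ω}
  {ν : Fin K → Measure ℝ} {X : Fin K → ℕ → Ω → ℝ}

lemma iIndepFun_arm (h : IsRewardTable P ν X) (k : Fin K) : iIndepFun (X k) P :=
  h.indep.comp (fun _ v => v k) (fun _ => measurable_pi_apply k)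

lemma lintegral_neg_le (h : IsRewardTable P ν X) {k : Fin K}
    (hint : Integrable (fun y : ℝ => y) (ν k)) {B : ℝ} (hB : ∫ y, max (-y) 0 ∂(ν k) ≤ B) (t : ℕ) :
    ∫⁻ ω, ENNReal.ofReal (-X k t ω) ∂P ≤ ENNReal.ofReal B := by
  have h1 : ∫⁻ ω, ENNReal.ofReal (-X k t ω) ∂P = ∫⁻ y, ENNReal.ofReal (-y) ∂(ν k) := by
    rw [← h.law k t, lintegral_map (by fun_prop) (h.measurable k t)]
  have h2 : ∫⁻ y, ENNReal.ofReal (-y) ∂(ν k) = ∫⁻ y, ENNReal.ofReal (max (-y) 0) ∂(ν k) := by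
    simp
  rw [h1, h2, ← ofReal_integral_eq_lintegral_ofReal hint.neg_part
    (.of_forall fun y => le_max_right _ _)]
  exact ENNReal.ofReal_le_ofReal hB

lemma integrable (h : IsRewardTable P ν X) {k : Fin K}
    (hint : Integrable (fun y : ℝ => y) (ν k)) (t : ℕ) : Integrable (X k t) P := by
  rw [← h.law k t] at hint
  exact hint.comp_measurable (h.measurable k t)

/-- Only different rounds are independent; the arms may depend on each other within a round. Hence
the condition `s ∉ S`, and hence early rewards are later compared with the maximum over the rounds
after exploration. -/
lemma measure_sup'_le_inter (h : IsRewardTable P ν X) (k j : Fin K) {S : Finset ℕ}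
    (hS : S.Nonempty) {s : ℕ} (hs : s ∉ S) (x : ℝ) :
    P {ω | S.sup' hS (fun t => X k t ω) ≤ x ∧ x < X j s ω} ≤
      P {ω | S.sup' hS (fun t => X k t ω) ≤ x} * P {ω | x < X j s ω} := by
  have hprod := h.indep.measure_inter_preimage_eq_mul (insert s S)
    (sets := fun t => if t = s then {v : Fin K → ℝ | x < v j} else {v : Fin K → ℝ | v k ≤ x})
    (fun t _ => by
      split_ifs
      · exact measurableSet_lt measurable_const (measurable_pi_apply j)
      · exact measurableSet_le (measurable_pi_apply k) measurable_const)
  have hne : ∀ t ∈ S, t ≠ s := fun t ht he => hs (he ▸ ht)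
  rw [Finset.prod_insert hs, Finset.prod_congr rfl (g := fun t => P {ω | X k t ω ≤ x})
    (fun t ht => by simp only [if_neg (hne t ht)]; rfl),
    ← measure_sup'_le_le (h.iIndepFun_arm k) hS, mul_comm] at hprod
  simp only [if_true] at hprod
  refine le_of_eq (Eq.trans (congrArg P ?_) hprod)
  ext ω
  simp only [Finset.sup'_le_iff, Set.mem_ofPred_eq, Set.mem_iInter, Finset.mem_insert,
    forall_eq_or_imp, Set.mem_preimage, if_true]
  rw [and_comm]
  refine and_congr Iff.rfl (forall₂_congr fun t ht => ?_)
  rw [if_neg (hne t ht)]; rfl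

variable [IsProbabilityMeasure P]

lemma isProbabilityMeasure (h : IsRewardTable P ν X) (k : Fin K) : IsProbabilityMeasure (ν k) := by
  rw [← h.law k 0]
  exact Measure.isProbabilityMeasure_map (h.measurable k 0).aemeasurable

lemma measure_le (h : IsRewardTable P ν X) (k : Fin K) (t : ℕ) (x : ℝ) :
    P {ω | X k t ω ≤ x} = ENNReal.ofReal (cdf (ν k) x) := by
  have := h.isProbabilityMeasure k
  rw [ofReal_cdf, ← h.law k t, Measure.map_apply (h.measurable k t) measurableSet_Iic]
  rfl

lemma measureReal_lt (h : IsRewardTable P ν X) (k : Fin K) (t : ℕ) (x : ℝ) :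
    P.real {ω | x < X k t ω} = 1 - cdf (ν k) x := by
  have hs : {ω | x < X k t ω} = {ω | X k t ω ≤ x}ᶜ := by ext ω; simp
  rw [hs, probReal_compl_eq_one_sub (measurableSet_le (h.measurable k t) measurable_const),
    Measure.real, h.measure_le, ENNReal.toReal_ofReal (cdf_nonneg _ _)]

lemma measure_lt_le (h : IsRewardTable P ν X) (k : Fin K) (t : ℕ) {α b C C' : ℝ}
    (hG : IsParetoTail α b C C' fun u => 1 - cdf (ν k) u) (hα : 0 < α) (hb : 0 < b) (hC' : 0 < C')
    {x : ℝ} (hx : 1 ≤ x) :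
    P {ω | x < X k t ω} ≤ ENNReal.ofReal ((C + C') * x ^ (-α)) := by
  rw [← ENNReal.ofReal_toReal (measure_ne_top P _)]
  refine ENNReal.ofReal_le_ofReal ?_
  rw [← Measure.real, h.measureReal_lt]
  exact hG.le_rpow hα hb hC' hx

lemma heavyTail (h : IsRewardTable P ν X) (k : Fin K) {x₀ c α : ℝ}
    (hG : ∀ x, x₀ ≤ x → c * x ^ (-α) ≤ 1 - cdf (ν k) x) : HeavyTail P (X k) x₀ c α := by
  intro s x hx
  rw [h.measure_le]
  refine ENNReal.ofReal_le_ofReal ?_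
  linarith [hG x hx, Real.add_one_le_exp (-(c * x ^ (-α)))]

end IsRewardTable

/-! ### Runs of the strategies -/

/-- The rounds of the exploration phase in which arm `k` is pulled. -/
def block (N k : ℕ) : Finset ℕ := Finset.Ico (k * N) ((k + 1) * N)

lemma card_block (N k : ℕ) : (block N k).card = N := by
  rw [block, Nat.card_Ico, add_mul, one_mul, Nat.add_sub_cancel_left]

/-- The rounds before round `t` in which arm `k` is pulled, if after the exploration phase only
`kstar` is pulled. -/
def sampleSet {K : ℕ} (N : ℕ) (kstar k : Fin K) (t : ℕ) : Finset ℕ :=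
  if k = kstar then block N k ∪ Finset.Ico (K * N) t else block N k

lemma block_lt {K N : ℕ} (k : Fin K) {s : ℕ} (hs : s ∈ block N k) : s < K * N := by
  rw [block, Finset.mem_Ico] at hs
  exact hs.2.trans_le (Nat.mul_le_mul_right N k.2)

lemma le_card_sampleSet {K N : ℕ} (kstar k : Fin K) (t : ℕ) :
    N ≤ (sampleSet N kstar k t).card := by
  rw [sampleSet]
  split_ifs
  · exact (card_block N k).ge.trans (Finset.card_le_card Finset.subset_union_left)
  · exact (card_block N k).ge

lemma card_sampleSet_of_ne {K N : ℕ} {kstar k : Fin K} (h : k ≠ kstar) (t : ℕ) :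
    (sampleSet N kstar k t).card = N := by
  rw [sampleSet, if_neg h, card_block]

lemma card_sampleSet_le {K N : ℕ} (kstar k : Fin K) {t : ℕ} (ht : K * N ≤ t) :
    (sampleSet N kstar k t).card ≤ t := by
  have : sampleSet N kstar k t ⊆ Finset.range t := by
    intro s hs
    rw [Finset.mem_range]
    rw [sampleSet] at hs
    split_ifs at hs
    · rcases Finset.mem_union.1 hs with h | h
      · exact (block_lt k h).trans_le ht
      · exact (Finset.mem_Ico.1 h).2
    · exact (block_lt k hs).trans_le ht
  simpa using Finset.card_le_card this

section Run

variable {K : ℕ} {θ : Tuning} {n : ℕ} {I : ℕ → Fin K} {kstar : Fin K}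

lemma Explores.eq_iff (h : Explores θ n I) (hN : 0 < θ.N n) {s : ℕ} (hs : s < K * θ.N n)
    (hsn : s < n) (k : Fin K) : I s = k ↔ s ∈ block (θ.N n) k := by
  rw [Fin.ext_iff, h s hsn hs, block, Finset.mem_Ico, Nat.div_eq_iff hN]
  constructor
  · rintro ⟨h1, h2⟩
    exact ⟨h1, by rw [add_mul]; omega⟩
  · rintro ⟨h1, h2⟩
    exact ⟨h1, by rw [add_mul] at h2; omega⟩

lemma Explores.pulls_eq (h : Explores θ n I) (hN : 0 < θ.N n) {t : ℕ} (ht : K * θ.N n ≤ t)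
    (htn : t ≤ n) (hI : ∀ s, K * θ.N n ≤ s → s < t → I s = kstar) (k : Fin K) :
    pulls I k t = sampleSet (θ.N n) kstar k t := by
  ext s
  rw [pulls, Finset.mem_filter, Finset.mem_range]
  rcases lt_or_ge s (K * θ.N n) with hs | hs
  · rw [h.eq_iff hN hs (by omega), sampleSet]
    split_ifs
    · simp only [Finset.mem_union, Finset.mem_Ico]
      exact ⟨fun h => .inl h.2, fun h => ⟨by omega, h.resolve_right (by omega)⟩⟩
    · exact ⟨fun h => h.2, fun h => ⟨by omega, h⟩⟩
  · have hnb : s ∉ block (θ.N n) k := fun hb => absurd (block_lt k hb) (not_lt.2 hs)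
    rw [sampleSet]
    split_ifs with hk
    · simp only [Finset.mem_union, Finset.mem_Ico, hnb, false_or]
      exact ⟨fun h => ⟨hs, h.1⟩, fun h => ⟨h.2, (hI s hs h.2).trans hk.symm⟩⟩
    · simp only [hnb, iff_false, not_and]
      intro hst he
      exact hk (he.symm.trans (hI s hs hst))

/-- As long as the indices computed from the deterministic samples favour `kstar`, both strategies
pull `kstar` after the exploration phase. -/
theorem IsRun.eq_kstar {alg : Algorithm} {x : Fin K → ℕ → ℝ} (h : IsRun alg θ n x I)
    (hN : 0 < θ.N n)
    (hidx : ∀ t, K * θ.N n ≤ t → t < n → ∀ k, k ≠ kstar →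
      θ.index n (sampleSet (θ.N n) kstar k t) (x k) <
        θ.index n (sampleSet (θ.N n) kstar kstar t) (x kstar)) :
    ∀ t, K * θ.N n ≤ t → t < n → I t = kstar := by
  obtain ⟨hexp, halg⟩ := h
  have hbest : ∀ t, K * θ.N n ≤ t → t < n → (∀ s, K * θ.N n ≤ s → s < t → I s = kstar) →
      ∀ k, IsBestIndex θ n x I t k → k = kstar := by
    intro t ht htn hI k hk
    by_contra hne
    have h1 := hk kstar
    rw [hexp.pulls_eq hN ht htn.le hI, hexp.pulls_eq hN ht htn.le hI] at h1
    exact absurd (hidx t ht htn k hne) (not_lt.2 h1)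
  cases alg with
  | extremeETC =>
    obtain ⟨w, hw, hIw⟩ := halg
    intro t ht htn
    rw [hIw t htn ht]
    exact hbest _ le_rfl (by omega) (fun s h1 h2 => absurd h2 (not_lt.2 h1)) w hw
  | extremeHunter =>
    intro t
    -- If all earlier rounds after exploration went to `kstar`, the samples at time `t` are the
    -- deterministic ones, for which `kstar` has the strictly largest index.
    induction t using Nat.strong_induction_on with
    | _ t ih =>
      intro ht htn
      exact hbest t ht htn (fun s h1 h2 => ih s h2 h1 (by omega)) _ (halg t htn ht)

end Run

/-! ### Pathwise comparison of maxima -/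

lemma le_iSup_fin {n : ℕ} (f : ℕ → ℝ) {t : ℕ} (ht : t < n) : f t ≤ ⨆ t : Fin n, f t :=
  le_ciSup (f := fun t : Fin n => f t) (Set.finite_range _).bddAbove ⟨t, ht⟩

lemma iSup_fin_eq_sup' {n : ℕ} (hn : 0 < n) (f : ℕ → ℝ) :
    ⨆ t : Fin n, f t = (Finset.range n).sup' (Finset.nonempty_range_iff.2 hn.ne') f := by
  have : Nonempty (Fin n) := ⟨⟨0, hn⟩⟩
  refine le_antisymm (ciSup_le fun t => Finset.le_sup' f (Finset.mem_range.2 t.2))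
    (Finset.sup'_le _ _ fun t ht => le_iSup_fin f (Finset.mem_range.1 ht))

/-- If only `kstar` is pulled from round `m` on, the maximal collected reward exceeds the maximum of
`kstar` over these rounds only through earlier rewards. -/
lemma iSup_fin_le_sup'_add_sum {K n m : ℕ} {X : Fin K → ℕ → ℝ} {kstar : Fin K} (hmn : m < n)
    {I : ℕ → Fin K} (hI : ∀ t, m ≤ t → t < n → I t = kstar) (hS : (Finset.Ico m n).Nonempty) :
    ⨆ t : Fin n, X (I t) t ≤ (Finset.Ico m n).sup' hS (X kstar) +
      ∑ k, ∑ s ∈ Finset.range m, max (X k s - (Finset.Ico m n).sup' hS (X kstar)) 0 := by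
  have : Nonempty (Fin n) := ⟨⟨m, hmn⟩⟩
  set M := (Finset.Ico m n).sup' hS (X kstar)
  have hpos : ∀ k, 0 ≤ ∑ s ∈ Finset.range m, max (X k s - M) 0 := fun k =>
    Finset.sum_nonneg fun s _ => le_max_right _ _
  refine ciSup_le fun t => ?_
  rcases lt_or_ge (t : ℕ) m with h | h
  · have h1 := Finset.single_le_sum (fun k _ => hpos k) (Finset.mem_univ (I t))
    have h2 := Finset.single_le_sum (f := fun s => max (X (I t) s - M) 0)
      (fun s _ => le_max_right _ _) (Finset.mem_range.2 h)
    have h3 := le_max_left (X (I t) t - M) 0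
    linarith
  · rw [hI t h t.2]
    have h1 := Finset.le_sup' (X kstar) (Finset.mem_Ico.2 ⟨h, t.2⟩)
    have h2 := Finset.sum_nonneg fun k (_ : k ∈ Finset.univ) => hpos k
    linarith

/-- Both maxima lie between the late maximum of `kstar` and that maximum plus the same sum, which
does not depend on the arms pulled early. -/
lemma abs_iSup_sub_iSup_le_of_eq {K n m : ℕ} {X : Fin K → ℕ → ℝ} {kstar : Fin K} (hmn : m < n)
    {I : ℕ → Fin K} (hI : ∀ t, m ≤ t → t < n → I t = kstar) (hS : (Finset.Ico m n).Nonempty) :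
    |(⨆ t : Fin n, X kstar t) - ⨆ t : Fin n, X (I t) t| ≤
      ∑ k, ∑ s ∈ Finset.range m, max (X k s - (Finset.Ico m n).sup' hS (X kstar)) 0 := by
  have h1 := iSup_fin_le_sup'_add_sum (X := X) hmn hI hS
  have h2 := iSup_fin_le_sup'_add_sum (X := X) (I := fun _ => kstar) hmn (fun _ _ _ => rfl) hS
  have h3 : (Finset.Ico m n).sup' hS (X kstar) ≤ ⨆ t : Fin n, X kstar t :=
    Finset.sup'_le _ _ fun t ht => le_iSup_fin (X kstar) (Finset.mem_Ico.1 ht).2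
  have h4 : (Finset.Ico m n).sup' hS (X kstar) ≤ ⨆ t : Fin n, X (I t) t :=
    Finset.sup'_le _ _ fun t ht => by
      obtain ⟨ht1, ht2⟩ := Finset.mem_Ico.1 ht
      rw [← hI t ht1 ht2]
      exact le_iSup_fin (fun t => X (I t) t) ht2
  exact abs_le.2 ⟨by linarith, by linarith⟩

lemma iSup_fin_le_add_sum {K n : ℕ} {X : Fin K → ℕ → ℝ} (hn : 0 < n) (I : ℕ → Fin K) (u : ℝ) :
    ⨆ t : Fin n, X (I t) t ≤ u + ∑ k, ∑ s ∈ Finset.range n, max (X k s - u) 0 := by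
  have : Nonempty (Fin n) := ⟨⟨0, hn⟩⟩
  have hpos : ∀ k, 0 ≤ ∑ s ∈ Finset.range n, max (X k s - u) 0 := fun k =>
    Finset.sum_nonneg fun s _ => le_max_right _ _
  refine ciSup_le fun t => ?_
  have h1 := Finset.single_le_sum (fun k _ => hpos k) (Finset.mem_univ (I t))
  have h2 := Finset.single_le_sum (f := fun s => max (X (I t) s - u) 0)
    (fun s _ => le_max_right _ _) (Finset.mem_range.2 t.2)
  have h3 := le_max_left (X (I t) t - u) 0
  linarith

/-- The crude comparison for the bad event. Both maxima are at most `u` plus the excesses over `u`;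
both are bounded below through the rewards of `kstar` in `S`, collected in either case. -/
lemma abs_iSup_sub_iSup_le {K n : ℕ} {X : Fin K → ℕ → ℝ} {kstar : Fin K} (hn : 0 < n)
    {I : ℕ → Fin K} {S : Finset ℕ} (hS : S.Nonempty) (hI : ∀ t ∈ S, t < n ∧ I t = kstar)
    {u x₀ : ℝ} (hx₀ : 0 ≤ x₀) :
    |(⨆ t : Fin n, X kstar t) - ⨆ t : Fin n, X (I t) t| ≤
      u + ∑ k, ∑ s ∈ Finset.range n, max (X k s - u) 0 + max (x₀ - S.sup' hS (X kstar)) 0 := by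
  have h1 := iSup_fin_le_add_sum (X := X) hn I u
  have h2 := iSup_fin_le_add_sum (X := X) hn (fun _ => kstar) u
  have h3 : S.sup' hS (X kstar) ≤ ⨆ t : Fin n, X kstar t :=
    Finset.sup'_le _ _ fun t ht => le_iSup_fin (X kstar) (hI t ht).1
  have h4 : S.sup' hS (X kstar) ≤ ⨆ t : Fin n, X (I t) t :=
    Finset.sup'_le _ _ fun t ht => by
      rw [← (hI t ht).2]
      exact le_iSup_fin (fun t => X (I t) t) (hI t ht).1
  have h5 := le_max_left (x₀ - S.sup' hS (X kstar)) 0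
  exact abs_le.2 ⟨by linarith, by linarith⟩

/-! ### Expected maxima and their differences -/

section Regret

variable {K : ℕ} {Ω : Type*} [MeasurableSpace Ω] {P : Measure Ω} {ν : Fin K → Measure ℝ}
  {X : Fin K → ℕ → Ω → ℝ}

lemma IsRewardTable.measurable_iSup_fin (h : IsRewardTable P ν X) {n : ℕ} {I : ℕ → Ω → Fin K}
    (hI : ∀ t < n, Measurable (I t)) : Measurable fun ω => ⨆ t : Fin n, X (I t ω) t ω := by
  refine Measurable.iSup fun t => ?_
  have : (fun ω => X (I t ω) t ω) =
      (fun q : Fin K × Ω => X q.1 t q.2) ∘ fun ω => (I t ω, ω) := rfl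
  rw [this]
  exact (measurable_from_prod_countable_right fun k => h.measurable k t).comp
    ((hI t t.2).prodMk measurable_id)

lemma IsRewardTable.integrable_iSup_fin (h : IsRewardTable P ν X)
    (hint : ∀ k, Integrable (fun y : ℝ => y) (ν k)) {n : ℕ} (hn : 0 < n) {I : ℕ → Ω → Fin K}
    (hI : ∀ t < n, Measurable (I t)) : Integrable (fun ω => ⨆ t : Fin n, X (I t ω) t ω) P := by
  have hs : Integrable (fun ω => ∑ k, ∑ t ∈ Finset.range n, |X k t ω|) P :=
    integrable_finsetSum _ fun k _ => integrable_finsetSum _ fun t _ =>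
      (h.integrable (hint k) t).abs
  refine hs.mono' (h.measurable_iSup_fin hI).aestronglyMeasurable (.of_forall fun ω => ?_)
  have : Nonempty (Fin n) := ⟨⟨0, hn⟩⟩
  have hle : ∀ t : Fin n, |X (I t ω) t ω| ≤ ∑ k, ∑ t ∈ Finset.range n, |X k t ω| := fun t => by
    refine (Finset.single_le_sum (f := fun s => |X (I t ω) s ω|) (fun s _ => abs_nonneg _)
      (Finset.mem_range.2 t.2)).trans ?_
    exact Finset.single_le_sum (f := fun k => ∑ s ∈ Finset.range n, |X k s ω|)
      (fun k _ => Finset.sum_nonneg fun s _ => abs_nonneg _) (Finset.mem_univ (I t ω))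
  rw [Real.norm_eq_abs, abs_le]
  refine ⟨?_, ciSup_le fun t => (abs_le.1 (hle t)).2⟩
  exact (abs_le.1 (hle ⟨0, hn⟩)).1.trans (le_iSup_fin (fun t => X (I t ω) t ω) hn)

variable [IsProbabilityMeasure P]

/-- A plain union bound, legitimate because the samples and the levels are deterministic. -/
lemma IsRewardTable.measure_exists_not_concentrated_le (h : IsRewardTable P ν X)
    (thr : Fin K → ℕ → ℕ → ℝ) (S : Fin K → ℕ → Finset ℕ) (n J : ℕ) {L : ℝ} (hL : 0 < L) :
    P {ω | ∃ k, ∃ t < n, ∃ j < J, ¬ Concentrated L ((S k t).card * (1 - cdf (ν k) (thr k t j)))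
      (exceedances (S k t) (fun s => X k s ω) (thr k t j))} ≤
      ENNReal.ofReal (K * n * J * (2 * Real.exp (-L))) := by
  set A : Fin K × ℕ × ℕ → Set Ω := fun i => {ω | ¬ Concentrated L
    ((S i.1 i.2.1).card * (1 - cdf (ν i.1) (thr i.1 i.2.1 i.2.2)))
    (exceedances (S i.1 i.2.1) (fun s => X i.1 s ω) (thr i.1 i.2.1 i.2.2))} with hA
  set F : Finset (Fin K × ℕ × ℕ) := Finset.univ ×ˢ Finset.range n ×ˢ Finset.range J with hF
  have hsub : {ω | ∃ k, ∃ t < n, ∃ j < J,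
      ¬ Concentrated L ((S k t).card * (1 - cdf (ν k) (thr k t j)))
      (exceedances (S k t) (fun s => X k s ω) (thr k t j))} ⊆ ⋃ i ∈ F, A i := by
    rintro ω ⟨k, t, ht, j, hj, hc⟩
    refine Set.mem_iUnion₂.2 ⟨(k, t, j), ?_, hc⟩
    simp [hF, ht, hj]
  have hone : ∀ i ∈ F, P (A i) ≤ ENNReal.ofReal (2 * Real.exp (-L)) := fun i _ => by
    rw [← ENNReal.ofReal_toReal (measure_ne_top P (A i))]
    exact ENNReal.ofReal_le_ofReal (measureReal_not_concentrated_le (h.measurable i.1)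
      (h.iIndepFun_arm i.1) (fun s => h.measureReal_lt i.1 s _) _ hL)
  refine (measure_mono hsub).trans ((measure_biUnion_finset_le F A).trans
    ((Finset.sum_le_sum hone).trans (le_of_eq ?_)))
  rw [Finset.sum_const, nsmul_eq_mul, ← ENNReal.ofReal_natCast,
    ← ENNReal.ofReal_mul (by positivity)]
  congr 2
  simp [hF, Finset.card_product, mul_assoc]

lemma ofReal_sum_sum_max_eq {K : ℕ} (T : Finset ℕ) (f : Fin K → ℕ → ℝ) :
    ENNReal.ofReal (∑ k, ∑ s ∈ T, max (f k s) 0) = ∑ k, ∑ s ∈ T, ENNReal.ofReal (f k s) := by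
  rw [ENNReal.ofReal_sum_of_nonneg fun k _ => Finset.sum_nonneg fun s _ => le_max_right _ _]
  refine Finset.sum_congr rfl fun k _ => ?_
  rw [ENNReal.ofReal_sum_of_nonneg fun s _ => le_max_right _ _]
  simp

lemma sum_sum_le_ofReal {K : ℕ} (m : ℕ) {f : Fin K → ℕ → ℝ≥0∞} {c : ℝ}
    (h : ∀ k, ∀ s ∈ Finset.range m, f k s ≤ ENNReal.ofReal c) :
    ∑ k, ∑ s ∈ Finset.range m, f k s ≤ ENNReal.ofReal (K * m * c) := by
  refine (Finset.sum_le_sum fun k _ => Finset.sum_le_sum (h k)).trans (le_of_eq ?_)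
  simp only [Finset.sum_const, Finset.card_range, Finset.card_univ, Fintype.card_fin, nsmul_eq_mul]
  rw [← ENNReal.ofReal_natCast, ← ENNReal.ofReal_natCast, ← ENNReal.ofReal_mul (by positivity),
    ← ENNReal.ofReal_mul (by positivity), mul_assoc]

/-- The expected distance between the maximal reward of `kstar` and the maximal reward collected by
a strategy that pulls `kstar` from round `m` on, outside an event of small probability. -/
theorem IsRewardTable.lintegral_abs_iSup_sub_iSup_le (h : IsRewardTable P ν X) {kstar : Fin K}
    {x₀ c α B₀ c₂ u p : ℝ} (hheavy : HeavyTail P (X kstar) x₀ c α)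
    (hneg : ∀ t, ∫⁻ ω, ENNReal.ofReal (-X kstar t ω) ∂P ≤ ENNReal.ofReal B₀)
    (htail : ∀ k t x, 1 ≤ x → P {ω | x < X k t ω} ≤ ENNReal.ofReal (c₂ * x ^ (-α)))
    (hx₀ : 1 ≤ x₀) (hc : 0 < c) (hα : 1 < α) (hc₂ : 0 ≤ c₂) (hu : 1 ≤ u) (hp : 0 ≤ p)
    {n m : ℕ} (hmn : m < n) {I : ℕ → Ω → Fin K} {bad : Set Ω} (hbad : P bad ≤ ENNReal.ofReal p)
    (hgood : ∀ ω ∉ bad, ∀ t, m ≤ t → t < n → I t ω = kstar)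
    {S : Finset ℕ} (hS : S.Nonempty) (hI : ∀ ω, ∀ t ∈ S, t < n ∧ I t ω = kstar) :
    ∫⁻ ω, ENNReal.ofReal |(⨆ t : Fin n, X kstar t ω) - ⨆ t : Fin n, X (I t ω) t ω| ∂P ≤
      ENNReal.ofReal (K * m * ((x₀ + |B₀|) * Real.exp (-(c * x₀ ^ (-α) * (n - m - 1 : ℕ))) +
          (c₂ / c + c₂ / (α - 1)) * ((n - m : ℕ) : ℝ) ^ (-(1 - 1 / α))) +
        u * p + K * n * (c₂ / (α - 1) * u ^ (1 - α)) +
        (x₀ + |B₀|) * Real.exp (-(c * x₀ ^ (-α) * (S.card - 1 : ℕ)))) := by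
  have hIco : (Finset.Ico m n).Nonempty := Finset.nonempty_Ico.2 hmn
  have hu0 : 0 ≤ u := by linarith
  have hα1 : 0 < α - 1 := by linarith
  have hm := h.measurable
  have hMm := measurable_sup'_apply (hm kstar) hIco
  have hMm2 := measurable_sup'_apply (hm kstar) hS
  set f₁ : Ω → ℝ≥0∞ := fun ω => ∑ k, ∑ s ∈ Finset.range m,
    ENNReal.ofReal (X k s ω - (Finset.Ico m n).sup' hIco fun t => X kstar t ω) with hf₁
  -- The bad event is replaced by its measurable hull. Only the truncation level `u` is multiplied
  -- by its probability; `f₃` and `f₄` are integrated over the whole space.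
  set f₂ : Ω → ℝ≥0∞ := (toMeasurable P bad).indicator (fun _ => ENNReal.ofReal u) with hf₂
  set f₃ : Ω → ℝ≥0∞ := fun ω => ∑ k, ∑ s ∈ Finset.range n, ENNReal.ofReal (X k s ω - u) with hf₃
  set f₄ : Ω → ℝ≥0∞ := fun ω => ENNReal.ofReal (x₀ - S.sup' hS fun t => X kstar t ω) with hf₄
  have mM : ∀ k s, Measurable fun ω => ENNReal.ofReal
      (X k s ω - (Finset.Ico m n).sup' hIco fun t => X kstar t ω) := fun k s =>
    ((hm k s).sub hMm).ennreal_ofReal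
  have mu : ∀ k s, Measurable fun ω => ENNReal.ofReal (X k s ω - u) := fun k s =>
    ((hm k s).sub measurable_const).ennreal_ofReal
  have m1 : Measurable f₁ :=
    Finset.measurable_sum _ fun k _ => Finset.measurable_sum _ fun s _ => mM k s
  have m2 : Measurable f₂ := measurable_const.indicator (measurableSet_toMeasurable _ _)
  have m3 : Measurable f₃ :=
    Finset.measurable_sum _ fun k _ => Finset.measurable_sum _ fun s _ => mu k s
  have m12 : Measurable fun ω => f₁ ω + f₂ ω := m1.add m2
  have m123 : Measurable fun ω => f₁ ω + f₂ ω + f₃ ω := m12.add m3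
  have hpt : ∀ ω, ENNReal.ofReal |(⨆ t : Fin n, X kstar t ω) - ⨆ t : Fin n, X (I t ω) t ω| ≤
      f₁ ω + f₂ ω + f₃ ω + f₄ ω := by
    intro ω
    by_cases hω : ω ∈ toMeasurable P bad
    · have h1 := abs_iSup_sub_iSup_le (X := fun k t => X k t ω) (kstar := kstar) (u := u)
        (by omega) hS (hI ω) (x₀ := x₀) (by linarith)
      refine (ENNReal.ofReal_le_ofReal h1).trans ?_
      refine ENNReal.ofReal_add_le.trans (add_le_add
        (ENNReal.ofReal_add_le.trans (add_le_add ?_ ?_)) ?_)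
      · rw [hf₂, Set.indicator_of_mem hω]; exact le_add_left le_rfl
      · rw [ofReal_sum_sum_max_eq]
      · simp [hf₄]
    · have h1 := abs_iSup_sub_iSup_le_of_eq (X := fun k t => X k t ω) hmn
        (hgood ω fun hb => hω (subset_toMeasurable _ _ hb)) hIco
      refine (ENNReal.ofReal_le_ofReal h1).trans ?_
      rw [ofReal_sum_sum_max_eq, add_assoc, add_assoc]
      exact le_add_right le_rfl
  refine (lintegral_mono hpt).trans ?_
  rw [lintegral_add_left m123, lintegral_add_left m12, lintegral_add_left m1]
  have hγ : 0 ≤ (x₀ + |B₀|) * Real.exp (-(c * x₀ ^ (-α) * (n - m - 1 : ℕ))) +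
          (c₂ / c + c₂ / (α - 1)) * ((n - m : ℕ) : ℝ) ^ (-(1 - 1 / α)) := by positivity
  have hγ2 : 0 ≤ c₂ / (α - 1) * u ^ (1 - α) := by positivity
  rw [ENNReal.ofReal_add (by positivity) (by positivity),
    ENNReal.ofReal_add (by positivity) (by positivity),
    ENNReal.ofReal_add (by positivity) (by positivity)]
  refine add_le_add (add_le_add (add_le_add ?_ ?_) ?_) ?_
  · rw [hf₁, lintegral_finsetSum _ fun k _ => Finset.measurable_sum _ fun s _ =>
      mM k s]
    simp_rw [lintegral_finsetSum _ fun s _ => mM _ s]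
    refine sum_sum_le_ofReal m fun k s hs => ?_
    have hsn : s ∉ Finset.Ico m n := by
      rw [Finset.mem_Ico]; have := Finset.mem_range.1 hs; omega
    have := hheavy.lintegral_sub_sup'_le (h.iIndepFun_arm kstar) (hm kstar) (hm k s) hx₀ hc hα
      hc₂ hneg hIco (h.measure_sup'_le_inter kstar k hIco hsn) (htail k s)
    rwa [Nat.card_Ico] at this
  · rw [hf₂, lintegral_indicator (measurableSet_toMeasurable _ _), setLIntegral_const,
      measure_toMeasurable, ENNReal.ofReal_mul hu0]
    gcongr
  · rw [hf₃, lintegral_finsetSum _ fun k _ => Finset.measurable_sum _ fun s _ =>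
      mu k s]
    simp_rw [lintegral_finsetSum _ fun s _ => mu _ s]
    exact sum_sum_le_ofReal n fun k s _ =>
      lintegral_ofReal_sub_const_le (hm k s) hc₂ hα hu (htail k s)
  · exact hheavy.lintegral_const_sub_le (h.iIndepFun_arm kstar) (hm kstar) (by linarith) hneg hS

/-- Upper bound for the expected maximum of an arm. -/
lemma IsRewardTable.integral_iSup_le (h : IsRewardTable P ν X)
    (hint : ∀ k, Integrable (fun y : ℝ => y) (ν k)) {k : Fin K} {α c₂ : ℝ} (hα : 1 < α)
    (hc₂ : 0 ≤ c₂) (htail : ∀ t x, 1 ≤ x → P {ω | x < X k t ω} ≤ ENNReal.ofReal (c₂ * x ^ (-α)))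
    {n : ℕ} (hn : 0 < n) :
    ∫ ω, (⨆ t : Fin n, X k t ω) ∂P ≤ (1 + c₂ / (α - 1)) * (n : ℝ) ^ (1 / α) := by
  have hα1 : 0 < α - 1 := by linarith
  have hn1 : (1 : ℝ) ≤ n := by exact_mod_cast hn
  have hn0 : (0 : ℝ) < n := by linarith
  set u := (n : ℝ) ^ (1 / α) with hu
  have hu1 : 1 ≤ u := Real.one_le_rpow hn1 (by positivity)
  refine integral_le_of_lintegral_ofReal_le
    (h.integrable_iSup_fin hint hn (I := fun _ _ => k) fun _ _ => measurable_const)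
    (by positivity) ?_
  have : Nonempty (Fin n) := ⟨⟨0, hn⟩⟩
  have hpt : ∀ ω, ENNReal.ofReal (⨆ t : Fin n, X k t ω) ≤
      ENNReal.ofReal u + ∑ t ∈ Finset.range n, ENNReal.ofReal (X k t ω - u) := by
    intro ω
    have h1 := ofReal_sum_sum_max_eq (K := 1) (Finset.range n) (fun _ t => X k t ω - u)
    have h2 := iSup_fin_le_add_sum (K := 1) (X := fun _ t => X k t ω) hn (fun _ => 0) u
    simp only [Finset.univ_unique, Finset.sum_singleton] at h1 h2
    rw [← h1]
    exact (ENNReal.ofReal_le_ofReal h2).trans ENNReal.ofReal_add_le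
  refine (lintegral_mono hpt).trans ?_
  have mu : ∀ s, Measurable fun ω => ENNReal.ofReal (X k s ω - u) := fun s =>
    ((h.measurable k s).sub measurable_const).ennreal_ofReal
  rw [lintegral_add_left measurable_const, lintegral_finsetSum _ fun s _ => mu s,
    lintegral_const, measure_univ,
    mul_one, add_mul, one_mul, ENNReal.ofReal_add (by positivity) (by positivity)]
  gcongr
  have h1 := sum_sum_le_ofReal (K := 1) n (c := c₂ / (α - 1) * u ^ (1 - α))
    (f := fun _ s => ∫⁻ ω, ENNReal.ofReal (X k s ω - u) ∂P) fun _ s _ =>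
      lintegral_ofReal_sub_const_le (h.measurable k s) hc₂ hα hu1 (htail s)
  simp only [Finset.univ_unique, Finset.sum_singleton] at h1
  refine h1.trans (ENNReal.ofReal_le_ofReal (le_of_eq ?_))
  have h3 : (n : ℝ) * u ^ (1 - α) = u := by
    nth_rw 1 [← Real.rpow_one (n : ℝ)]
    rw [hu, ← Real.rpow_mul hn0.le, ← Real.rpow_add hn0]
    congr 1; field_simp; ring
  calc _ = c₂ / (α - 1) * (n * u ^ (1 - α)) := by push_cast; ring
    _ = _ := by rw [h3]

/-- Lower bound for the expected maximum of an arm. -/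
lemma IsRewardTable.le_integral_iSup (h : IsRewardTable P ν X)
    (hint : ∀ k, Integrable (fun y : ℝ => y) (ν k)) {k : Fin K} {x₀ c α B₀ : ℝ}
    (hheavy : HeavyTail P (X k) x₀ c α)
    (hneg : ∀ t, ∫⁻ ω, ENNReal.ofReal (-X k t ω) ∂P ≤ ENNReal.ofReal B₀)
    (hx₀ : 1 ≤ x₀) (hc : 0 < c) (hα : 1 < α) {n : ℕ} (hn : 0 < n) :
    (1 - Real.exp (-c)) * (n : ℝ) ^ (1 / α) - (x₀ + |B₀|) ≤ ∫ ω, (⨆ t : Fin n, X k t ω) ∂P := by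
  have hi := h.integrable_iSup_fin hint hn (I := fun _ _ => k) fun _ _ => measurable_const
  have h1 := hheavy.lintegral_rpow_sub_sup'_le (h.iIndepFun_arm k) (h.measurable k) hx₀ hc hα hneg
    (Finset.nonempty_range_iff.2 hn.ne' : (Finset.range n).Nonempty)
  simp_rw [Finset.card_range] at h1
  have h2 : ∫ ω, ((n : ℝ) ^ (1 / α) - ⨆ t : Fin n, X k t ω) ∂P ≤
      (x₀ + |B₀|) + Real.exp (-c) * (n : ℝ) ^ (1 / α) := by
    have hi2 : Integrable (fun ω => (n : ℝ) ^ (1 / α) - ⨆ t : Fin n, X k t ω) P :=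
      (integrable_const _).sub hi
    refine integral_le_of_lintegral_ofReal_le hi2 (by positivity) ?_
    refine le_trans (le_of_eq ?_) h1
    refine lintegral_congr fun ω => ?_
    rw [iSup_fin_eq_sup' hn (fun t => X k t ω)]
  rw [integral_sub (integrable_const _) hi, integral_const] at h2
  simp only [probReal_univ, smul_eq_mul, one_mul] at h2
  linarith

end Regret

/-! ### The best arm has the largest index -/

/-- The levels at which the exceedance counts of a sample of size `T` from an arm with tail index
`α` have to be concentrated. -/
def threshold (b ε α : ℝ) (n T j : ℕ) : ℝ :=
  if j ≤ ⌈Real.log n⌉₊ then Real.exp j else (T : ℝ) ^ ((1 / α + ε) / (2 * b + 1))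

/-- At `ε = 0` the conditions reduce to strict inequalities, the essential one being that the
midpoint of `1 / α k` and `1 / α kstar` separates the two. By continuity they persist for small `ε >
0`. -/
lemma exists_accuracy {K : ℕ} {α : Fin K → ℝ} {b : ℝ} {kstar : Fin K} (hα : ∀ k, 1 < α k)
    (hkstar : ∀ k, k ≠ kstar → α kstar < α k) (hb : 0 < b) :
    ∃ ε : ℝ, 0 < ε ∧ ∀ k, α k * ε ≤ b ∧ α k * ε < 1 ∧ ε < 1 / α k ∧ 1 / α k + 2 * ε < 1 ∧
      (k ≠ kstar → (1 + ε) * (1 / α k + 2 * ε) < (1 / α k + 1 / α kstar) / 2 ∧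
        (1 / α k + 1 / α kstar) / 2 < (1 - α kstar * ε) * (1 / α kstar - ε)) := by
  have key : ∀ f g : ℝ → ℝ, Continuous f → Continuous g → f 0 < g 0 →
      ∀ᶠ ε in 𝓝[>] (0 : ℝ), f ε < g ε :=
    fun f g hf hg h => nhdsWithin_le_nhds
      (hf.continuousAt.eventually_lt hg.continuousAt h)
  have hall : ∀ᶠ ε in 𝓝[>] (0 : ℝ), ∀ k, α k * ε ≤ b ∧ α k * ε < 1 ∧ ε < 1 / α k ∧
      1 / α k + 2 * ε < 1 ∧
      (k ≠ kstar → (1 + ε) * (1 / α k + 2 * ε) < (1 / α k + 1 / α kstar) / 2 ∧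
        (1 / α k + 1 / α kstar) / 2 < (1 - α kstar * ε) * (1 / α kstar - ε)) := by
    refine eventually_all.2 fun k => ?_
    have hk0 : 0 < α k := by linarith [hα k]
    have hk1 : 1 / α k < 1 := (div_lt_one hk0).2 (hα k)
    have hk2 : 0 < 1 / α k := by positivity
    refine ((key (fun ε => α k * ε) (fun _ => b) (by fun_prop) (by fun_prop) (by simpa)).mono
      fun _ h => h.le).and ?_
    refine (key (fun ε => α k * ε) (fun _ => 1) (by fun_prop) (by fun_prop) (by simp)).and ?_
    refine (key (fun ε => ε) (fun _ => 1 / α k) (by fun_prop) (by fun_prop) hk2).and ?_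
    refine (key (fun ε => 1 / α k + 2 * ε) (fun _ => 1) (by fun_prop) (by fun_prop)
      (by simpa using hk1)).and ?_
    by_cases hk : k = kstar
    · exact .of_forall fun _ h => absurd hk h
    · have hlt : 1 / α k < 1 / α kstar :=
        one_div_lt_one_div_of_lt (by linarith [hα kstar]) (hkstar k hk)
      refine ((key (fun ε => (1 + ε) * (1 / α k + 2 * ε)) (fun _ => (1 / α k + 1 / α kstar) / 2)
        (by fun_prop) (by fun_prop) ?_).and (key (fun _ => (1 / α k + 1 / α kstar) / 2)
        (fun ε => (1 - α kstar * ε) * (1 / α kstar - ε)) (by fun_prop) (by fun_prop) ?_)).mono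
        fun _ h _ => h
      · simp only [add_zero, one_mul, mul_zero]; linarith
      · simp only [mul_zero, sub_zero, one_mul]; linarith
  obtain ⟨ε, h, h0⟩ := (hall.and self_mem_nhdsWithin).exists
  exact ⟨ε, h0, h⟩

lemma Tuning.eventually_N_pos {θ : Tuning} (hA : 0 < θ.A₀) : ∀ᶠ n : ℕ in atTop, 0 < θ.N n := by
  filter_upwards [tendsto_log_natCast.eventually_gt_atTop 0] with n hn
  rw [N, Nat.ceil_pos]
  positivity

/-- For a long horizon the arm with the heaviest tail has the largest index, whenever the
exceedance counts of all arms are concentrated. -/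
theorem Tuning.exists_eventually_index_lt {K : ℕ} {α C : Fin K → ℝ} {C' : ℝ} {kstar : Fin K}
    {θ : Tuning} (hα : ∀ k, 1 < α k) (hC : ∀ k, 0 < C k) (hC' : 0 < C')
    (hkstar : ∀ k, k ≠ kstar → α kstar < α k) (hb : 0 < θ.b) (hρ : 0 < θ.ρ) (hA : 0 < θ.A₀)
    (hD : 0 ≤ θ.D) (hE : 0 ≤ θ.E) (ha : 52 ≤ θ.a) :
    ∃ ε : ℝ, ∀ᶠ n : ℕ in atTop, ∀ (G : Fin K → ℝ → ℝ) (x : Fin K → ℕ → ℝ),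
      (∀ k, IsParetoTail (α k) θ.b (C k) C' (G k)) →
      (∀ k, ∀ t < n, ∀ j < ⌈Real.log n⌉₊ + 2, Concentrated (Real.log (2 / θ.δ₀ n))
        ((sampleSet (θ.N n) kstar k t).card *
          G k (threshold θ.b ε (α k) n (sampleSet (θ.N n) kstar k t).card j))
        (exceedances (sampleSet (θ.N n) kstar k t) (x k)
          (threshold θ.b ε (α k) n (sampleSet (θ.N n) kstar k t).card j))) →
      ∀ t, K * θ.N n ≤ t → t < n → ∀ k, k ≠ kstar →
        θ.index n (sampleSet (θ.N n) kstar k t) (x k) <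
          θ.index n (sampleSet (θ.N n) kstar kstar t) (x kstar) := by
  obtain ⟨ε, hε, hεk⟩ := exists_accuracy hα hkstar hb
  refine ⟨ε, ?_⟩
  have hcons := fun k => exists_abs_hEst_sub_le (a := θ.a) (hα k) hb (hC k) hC' ha hε
  choose κ₁ hκ₁ hh using hcons
  obtain ⟨κ₂, hκ₂, hc⟩ := exists_le_cEst (a := θ.a) (hα kstar) hb (hC kstar) hC' hε (hεk kstar).1
  have hα0 : ∀ k, 0 < α k := fun k => by linarith [hα k]
  have up : ∀ᶠ n : ℕ in atTop, ∀ k, k ≠ kstar → ∀ (S : Finset ℕ) (x : ℕ → ℝ), S.card = θ.N n →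
      |hEst θ.a (θ.δ₀ n) S x - 1 / α k| ≤ ε →
      θ.index n S x < ENNReal.ofReal ((n : ℝ) ^ ((1 / α k + 1 / α kstar) / 2)) := by
    refine eventually_all.2 fun k => eventually_imp_distrib_left.2 fun hk => ?_
    obtain ⟨-, -, h3, h4, h5⟩ := hεk k
    exact eventually_index_lt hb hρ hA hD hE hε h3 h4 (h5 hk).1
  have lo : ∀ᶠ n : ℕ in atTop, ∀ k, k ≠ kstar → ∀ (S : Finset ℕ) (x : ℕ → ℝ),
      θ.N n ≤ S.card → S.card ≤ n → |hEst θ.a (θ.δ₀ n) S x - 1 / α kstar| ≤ ε →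
      C kstar / 6 * (S.card : ℝ) ^ (-(α kstar * ε)) ≤ cEst θ.b θ.a (θ.δ₀ n) S x →
      ENNReal.ofReal ((n : ℝ) ^ ((1 / α k + 1 / α kstar) / 2)) ≤ θ.index n S x := by
    refine eventually_all.2 fun k => eventually_imp_distrib_left.2 fun hk => ?_
    obtain ⟨-, h2, h3, -⟩ := hεk kstar
    exact eventually_le_index hb hρ hA hD hE (by have := hC kstar; positivity) (hα0 kstar) hε h3 h2
      ((hεk k).2.2.2.2 hk).2
  filter_upwards [up, lo, eventually_all.2 fun k => eventually_le_log_two_div_δ₀ hρ (κ₁ k),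
    eventually_le_log_two_div_δ₀ hρ κ₂,
    eventually_all.2 fun k => eventually_mul_log_le_rpow hb hA (κ₁ k),
    eventually_mul_log_le_rpow hb hA κ₂, eventually_N_pos hA] with n i1 i2 i3 i4 i5 i6 i7
  intro G x hG hconc t ht htn k hk
  have hcard : ∀ k, θ.N n ≤ (sampleSet (θ.N n) kstar k t).card := fun k => le_card_sampleSet _ _ _
  have hcard' : ∀ k, (sampleSet (θ.N n) kstar k t).card ≤ n := fun k =>
    (card_sampleSet_le kstar k ht).trans htn.le
  have hest : ∀ k, |hEst θ.a (θ.δ₀ n) (sampleSet (θ.N n) kstar k t) (x k) - 1 / α k| ≤ ε := by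
    intro k
    refine hh k _ _ _ (G k) (hG k) (i3 k) (i5 k _ (hcard k)) fun r hr => ?_
    have hr' : r ≤ ⌈Real.log n⌉₊ := by
      refine hr.trans (Nat.ceil_mono (Real.log_le_log ?_ (by exact_mod_cast hcard' k)))
      exact_mod_cast i7.trans_le (hcard k)
    have := hconc k t htn r (by omega)
    rwa [threshold, if_pos hr'] at this
  refine (i1 k hk _ _ (card_sampleSet_of_ne hk t) (hest k)).trans_le
    (i2 k hk _ _ (hcard kstar) (hcard' kstar) (hest kstar) ?_)
  refine hc _ _ _ (G kstar) (hG kstar) i4 (i6 _ (hcard kstar))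
    (by linarith [(abs_le.1 (hest kstar)).2]) ?_
  -- The one level beyond the powers of `e` is the threshold used by the estimator of `C`.
  have := hconc kstar t htn (⌈Real.log n⌉₊ + 1) (by omega)
  rwa [threshold, if_neg (by omega)] at this

/-! ### Negligible terms and the regret bound -/

lemma Tuning.two_mul_exp_neg {θ : Tuning} {n : ℕ} (hn : 0 < n) :
    2 * Real.exp (-Real.log (2 / θ.δ₀ n)) = (n : ℝ) ^ (-θ.ρ) := by
  have := δ₀_pos (θ := θ) hn
  rw [Real.exp_neg, Real.exp_log (by positivity), inv_div, mul_div_cancel₀ _ two_ne_zero, δ₀]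

/-- `N` is at least of order `log n ^ 2`, so `exp (-c N)` beats every power of `n`. -/
lemma Tuning.eventually_exp_neg_N_le {θ : Tuning} (hb : 0 < θ.b) (hA : 0 < θ.A₀) {c : ℝ}
    (hc : 0 < c) (γ : ℝ) :
    ∀ᶠ n : ℕ in atTop, Real.exp (-(c * (θ.N n - 1 : ℕ))) ≤ (n : ℝ) ^ (-γ) := by
  have h1 : Tendsto (fun n : ℕ => c * θ.A₀ * Real.log n + -γ) atTop atTop :=
    tendsto_atTop_add_const_right _ _ (tendsto_log_natCast.const_mul_atTop (by positivity))
  filter_upwards [h1.eventually_ge_atTop c, tendsto_log_natCast.eventually_ge_atTop 1,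
    eventually_gt_atTop 0, eventually_N_pos hA] with n h2 h3 h4 h5
  have hn0 : (0 : ℝ) < n := by exact_mod_cast h4
  rw [Real.rpow_def_of_pos hn0, Real.exp_le_exp, Nat.cast_sub h5, Nat.cast_one]
  have h6 : θ.A₀ * Real.log n ^ (2 * (2 * θ.b + 1) / θ.b) ≤ θ.N n := Nat.le_ceil _
  have h7 : Real.log n ^ 2 ≤ Real.log n ^ (2 * (2 * θ.b + 1) / θ.b) := by
    rw [← Real.rpow_natCast]
    refine Real.rpow_le_rpow_of_exponent_le h3 ?_
    rw [le_div_iff₀ hb]; push_cast; nlinarith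
  have h8 : θ.A₀ * Real.log n ^ 2 ≤ θ.N n := (mul_le_mul_of_nonneg_left h7 hA.le).trans h6
  have h9 := mul_le_mul_of_nonneg_left h8 hc.le
  have h10 := mul_le_mul_of_nonneg_right h2 (by linarith : 0 ≤ Real.log n)
  have h11 := mul_le_mul_of_nonneg_left h3 hc.le
  linarith

lemma Tuning.eventually_N_le {θ : Tuning} (hb : 0 < θ.b) (hA : 0 < θ.A₀) :
    ∀ᶠ n : ℕ in atTop, (θ.N n : ℝ) ≤ 2 * θ.A₀ * Real.log n ^ (2 * (2 * θ.b + 1) / θ.b) := by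
  have h1 : Tendsto (fun n : ℕ => Real.log n ^ (2 * (2 * θ.b + 1) / θ.b)) atTop atTop :=
    (tendsto_rpow_atTop (by positivity)).comp tendsto_log_natCast
  filter_upwards [(h1.const_mul_atTop hA).eventually_ge_atTop 1] with n hn
  have := Nat.ceil_lt_add_one (zero_le_one.trans hn)
  rw [N]
  linarith

lemma Tuning.eventually_mul_N_le {θ : Tuning} (K : ℕ) :
    ∀ᶠ n : ℕ in atTop, 2 * (K * θ.N n) ≤ n := by
  filter_upwards [eventually_N_le_rpow (θ := θ) (one_half_pos (α := ℝ)),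
    eventually_const_mul_rpow_lt (2 * K) (one_half_lt_one (α := ℝ))] with n h1 h2
  rw [Real.rpow_one] at h2
  have : (2 : ℝ) * (K * θ.N n) ≤ n := by
    calc (2 : ℝ) * (K * θ.N n) = 2 * K * θ.N n := by ring
      _ ≤ 2 * K * (n : ℝ) ^ (1 / 2 : ℝ) := by gcongr
      _ ≤ n := h2.le
  exact_mod_cast this

/-- The probability of atypical samples is negligible against the maximum of the rewards. -/
lemma eventually_rpow_mul_bad_le (K : ℕ) {s ρ γ : ℝ} (h : s + 1 + γ < ρ) :
    ∀ᶠ n : ℕ in atTop, (n : ℝ) ^ s * (K * n * (⌈Real.log n⌉₊ + 2 : ℕ) * (n : ℝ) ^ (-ρ)) ≤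
      (n : ℝ) ^ (-γ) := by
  set η := (ρ - (s + 1 + γ)) / 2 with hη
  have hη0 : 0 < η := by linarith
  filter_upwards [eventually_log_rpow_le 4 1 hη0, tendsto_log_natCast.eventually_ge_atTop 1,
    eventually_const_mul_rpow_lt K (by linarith : s + 1 + η - ρ < -γ), eventually_gt_atTop 0]
    with n h1 h2 h3 h4
  have hn0 : (0 : ℝ) < n := by exact_mod_cast h4
  rw [Real.rpow_one] at h1
  have h5 : ((⌈Real.log n⌉₊ + 2 : ℕ) : ℝ) ≤ (n : ℝ) ^ η := by
    have := Nat.ceil_lt_add_one (zero_le_one.trans h2)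
    push_cast
    linarith
  calc _ ≤ (n : ℝ) ^ s * (K * n * (n : ℝ) ^ η * (n : ℝ) ^ (-ρ)) := by gcongr
    _ = K * (n : ℝ) ^ (s + 1 + η - ρ) := by
        rw [sub_eq_add_neg, Real.rpow_add hn0, Real.rpow_add hn0, Real.rpow_add hn0, Real.rpow_one]
        ring
    _ ≤ _ := h3.le

lemma eventually_mul_rpow_add_le {c d e p q : ℝ} (he : 0 < e) (hpq : p < q) (hq : 0 < q) :
    ∀ᶠ n : ℕ in atTop, c * (n : ℝ) ^ p ≤ e * (n : ℝ) ^ q - d := by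
  filter_upwards [eventually_const_mul_rpow_lt (2 * c / e) hpq,
    eventually_const_mul_rpow_lt (2 * d / e) hq] with n h1 h2
  rw [Real.rpow_zero, mul_one, div_lt_iff₀ he] at h2
  rw [div_mul_eq_mul_div, div_lt_iff₀ he] at h1
  linarith

/-- The extreme regret of both strategies at horizon `n` is of the order
`(log n) ^ (2 (2 b + 1) / b) * n ^ (-(1 - 1 / α))`, where `α` is the tail index of the best arm. -/
theorem Tuning.exists_eventually_abs_expectedRegret_le {K : ℕ} {α β C : Fin K → ℝ} {C' : ℝ}
    {kstar : Fin K} {θ : Tuning} (hα : ∀ k, 1 < α k) (hC : ∀ k, 0 < C k) (hC' : 0 < C')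
    (hkstar : ∀ k, k ≠ kstar → α kstar < α k) (hb : 0 < θ.b) (hbβ : ∀ k, θ.b ≤ β k)
    (hρ : θ.ρ = 2 * α kstar / (α kstar - 1)) (hA : 0 < θ.A₀) (hD : 0 ≤ θ.D) (hE : 0 ≤ θ.E)
    (ha : 52 ≤ θ.a) (alg : Algorithm) (B : ℝ) :
    ∃ c : ℝ, ∀ᶠ n : ℕ in atTop,
      ∀ (Ω : Type*) [MeasurableSpace Ω] (P : Measure Ω) [IsProbabilityMeasure P]
        (ν : Fin K → Measure ℝ) (X : Fin K → ℕ → Ω → ℝ) (I : ℕ → Ω → Fin K),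
        (∀ k, IsSecondOrderPareto (α k) (β k) (C k) C' (ν k)) →
        (∀ k, Integrable (fun y : ℝ => y) (ν k)) →
        (∀ k, ∫ y, max (-y) 0 ∂(ν k) ≤ B) →
        IsRewardTable P ν X →
        (∀ t < n, Measurable (I t)) →
        (∀ ω, IsRun alg θ n (fun k t => X k t ω) (fun t => I t ω)) →
        |expectedRegret P X n I| ≤
          c * (Real.log n ^ (2 * (2 * θ.b + 1) / θ.b) * (n : ℝ) ^ (-(1 - 1 / α kstar))) := by
  set A := α kstar with hAdef
  have hA1 : 1 < A := hα kstar
  have hA0 : 0 < A := by linarith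
  have hA2 : 0 < A - 1 := by linarith
  have hρ0 : 0 < θ.ρ := by rw [hρ]; positivity
  obtain ⟨ε, hidx⟩ := exists_eventually_index_lt hα hC hC' hkstar hb hρ0 hA hD hE ha
  obtain ⟨x₀, hx₀, hlow⟩ := IsParetoTail.exists_le hA0 hb (hC kstar) hC'
  set c₁ := C kstar / 2 with hc₁
  have hc₁0 : 0 < c₁ := half_pos (hC kstar)
  set c₂ := ∑ k, C k + C' with hc₂
  have hCsum : ∀ k, C k ≤ ∑ k, C k := fun k =>
    Finset.single_le_sum (fun k _ => (hC k).le) (Finset.mem_univ k)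
  have hc₂0 : 0 < c₂ := by linarith [hCsum kstar, hC kstar]
  -- The truncation level `n ^ s` solves `n * (n ^ s) ^ (1 - A) = n ^ (-γ)`, so the excesses above
  -- it have the desired order. The given `ρ` exceeds `s + 1 + γ` by `1 / (A - 1)`, which leaves
  -- room for the logarithmic number of levels in the union bound.
  set s := (2 - 1 / A) / (A - 1) with hs
  set γ := 1 - 1 / A with hγ
  have hA3 : 1 / A < 1 := (div_lt_one hA0).2 hA1
  have hγ0 : 0 < γ := by linarith
  have hs0 : 0 < s := div_pos (by linarith) hA2
  have hsρ : s + 1 + γ < θ.ρ := by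
    have : θ.ρ - (s + 1 + γ) = 1 / (A - 1) := by
      rw [hρ, hs, hγ]; field_simp; ring
    have : 0 < 1 / (A - 1) := by positivity
    linarith
  have hsγ : 1 + s * (1 - A) = -γ := by rw [hs, hγ]; field_simp; ring
  set D := x₀ + |B| with hDdef
  have hD0 : 0 < D := by positivity
  set c₃ := c₁ * x₀ ^ (-A) with hc₃
  have hc₃0 : 0 < c₃ := by positivity
  set K₁ := c₂ / c₁ + c₂ / (A - 1) with hK₁
  have hK₁0 : 0 < K₁ := by positivity
  -- Eventually `kstar` also has the largest expected maximum, so the supremum in the regret is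
  -- attained there and maxima can be compared pathwise.
  have hsup : ∀ᶠ n : ℕ in atTop, ∀ k, k ≠ kstar →
      (1 + (C k + C') / (α k - 1)) * (n : ℝ) ^ (1 / α k) ≤
        (1 - Real.exp (-c₁)) * (n : ℝ) ^ (1 / A) - D := by
    refine eventually_all.2 fun k => eventually_imp_distrib_left.2 fun hk => ?_
    refine eventually_mul_rpow_add_le ?_ ?_ (by positivity)
    · rw [sub_pos, Real.exp_lt_one_iff]; linarith
    · exact one_div_lt_one_div_of_lt hA0 (hkstar k hk)
  -- In this order: early rewards above the late maximum of `kstar`, the bad event, excesses above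
  -- `n ^ s`, and a small maximum of `kstar` in its exploration block.
  refine ⟨K * K * (2 * θ.A₀) * (D + 2 * K₁) + 1 + K * (c₂ / (A - 1)) + D, ?_⟩
  filter_upwards [hidx, hsup, eventually_N_pos hA, eventually_mul_N_le (θ := θ) K,
    eventually_exp_neg_N_le hb hA hc₃0 γ, eventually_N_le hb hA, eventually_rpow_mul_bad_le K hsρ,
    tendsto_log_natCast.eventually_ge_atTop 1, eventually_gt_atTop 0,
    eventually_le_log_two_div_δ₀ hρ0 1]
    with n i1 i2 i3 i4 i5 i6 i7 i8 i9 i10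
  intro Ω _ P _ ν X I hpar hint hneg htab hIm hrun
  have hn1 : (1 : ℝ) ≤ n := by exact_mod_cast i9
  have hn0 : (0 : ℝ) < n := by linarith
  set N := θ.N n with hN
  set m := K * N with hm
  have hK : 0 < K := kstar.pos
  have hmN : N ≤ m := Nat.le_mul_of_pos_left N hK
  have hmn : m < n := by omega
  have hG : ∀ k, IsParetoTail (α k) θ.b (C k) C' fun u => 1 - cdf (ν k) u := fun k =>
    (hpar k).isParetoTail (by linarith [hα k]) hC' (hbβ k)
  have hheavy : HeavyTail P (X kstar) x₀ c₁ A := htab.heavyTail kstar (hlow _ (hG kstar))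
  have hneg' : ∀ k t, ∫⁻ ω, ENNReal.ofReal (-X k t ω) ∂P ≤ ENNReal.ofReal B := fun k t =>
    htab.lintegral_neg_le (hint k) (hneg k) t
  have htailk : ∀ k t x, 1 ≤ x →
      P {ω | x < X k t ω} ≤ ENNReal.ofReal ((C k + C') * x ^ (-α k)) := fun k t x hx =>
    htab.measure_lt_le k t (hG k) (by linarith [hα k]) hb hC' hx
  have htail : ∀ k t x, 1 ≤ x → P {ω | x < X k t ω} ≤ ENNReal.ofReal (c₂ * x ^ (-A)) := by
    intro k t x hx
    refine (htailk k t x hx).trans (ENNReal.ofReal_le_ofReal ?_)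
    have h1 : A ≤ α k := by
      by_cases hk : k = kstar
      · rw [hk]
      · exact (hkstar k hk).le
    have h2 : x ^ (-α k) ≤ x ^ (-A) := Real.rpow_le_rpow_of_exponent_le hx (by linarith)
    have := hCsum k
    have := hC k
    calc (C k + C') * x ^ (-α k) ≤ c₂ * x ^ (-α k) := by
          have : 0 ≤ x ^ (-α k) := by positivity
          gcongr; linarith
      _ ≤ _ := by gcongr
  -- the event that some exceedance count is atypical
  set bad : Set Ω := {ω | ∃ k, ∃ t < n, ∃ j < ⌈Real.log n⌉₊ + 2,
    ¬ Concentrated (Real.log (2 / θ.δ₀ n)) ((sampleSet N kstar k t).card * (1 - cdf (ν k)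
      (threshold θ.b ε (α k) n (sampleSet N kstar k t).card j)))
      (exceedances (sampleSet N kstar k t) (fun s => X k s ω)
        (threshold θ.b ε (α k) n (sampleSet N kstar k t).card j))} with hbad
  have hPbad := htab.measure_exists_not_concentrated_le
    (fun k t j => threshold θ.b ε (α k) n (sampleSet N kstar k t).card j)
    (fun k t => sampleSet N kstar k t) n (⌈Real.log n⌉₊ + 2) (zero_lt_one.trans_le i10)
  rw [two_mul_exp_neg i9] at hPbad
  have hgood : ∀ ω ∉ bad, ∀ t, m ≤ t → t < n → I t ω = kstar := by
    intro ω hω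
    refine (hrun ω).eq_kstar i3 (i1 (fun k u => 1 - cdf (ν k) u) (fun k t => X k t ω) hG ?_)
    intro k t ht j hj
    by_contra hc
    exact hω ⟨k, t, ht, j, hj, hc⟩
  have hblock : (block N kstar).Nonempty := by
    rw [← Finset.card_pos, card_block]; exact i3
  have hIblock : ∀ ω, ∀ t ∈ block N kstar, t < n ∧ I t ω = kstar := by
    intro ω t ht
    have h1 := block_lt kstar ht
    exact ⟨by omega, ((hrun ω).1.eq_iff i3 h1 (by omega) kstar).2 ht⟩
  have hu1 : 1 ≤ (n : ℝ) ^ s := Real.one_le_rpow hn1 hs0.le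
  have hmain := htab.lintegral_abs_iSup_sub_iSup_le hheavy (hneg' kstar) htail hx₀ hc₁0 hA1 hc₂0.le
    hu1 (by positivity) hmn hPbad hgood hblock hIblock
  rw [card_block] at hmain
  -- identification of the best single arm
  have hbest : (⨆ k : Fin K, ∫ ω, (⨆ t : Fin n, X k t ω) ∂P) =
      ∫ ω, (⨆ t : Fin n, X kstar t ω) ∂P := by
    have : Nonempty (Fin K) := ⟨kstar⟩
    refine le_antisymm (ciSup_le fun k => ?_)
      (le_ciSup (f := fun k => ∫ ω, (⨆ t : Fin n, X k t ω) ∂P) (Set.finite_range _).bddAbove kstar)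
    by_cases hk : k = kstar
    · rw [hk]
    · exact (htab.integral_iSup_le hint (hα k) (by linarith [hC k]) (htailk k) i9).trans
        ((i2 k hk).trans
          (htab.le_integral_iSup hint hheavy (hneg' kstar) hx₀ hc₁0 hA1 i9))
  have hi1 := htab.integrable_iSup_fin hint i9 (I := fun _ _ => kstar) fun _ _ => measurable_const
  have hi2 := htab.integrable_iSup_fin hint i9 hIm
  rw [expectedRegret, hbest, ← integral_sub hi1 hi2]
  have hi12 : Integrable
      (fun ω => |(⨆ t : Fin n, X kstar t ω) - ⨆ t : Fin n, X (I t ω) t ω|) P := (hi1.sub hi2).abs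
  refine abs_integral_le_integral_abs.trans
    (integral_le_of_lintegral_ofReal_le hi12 (by positivity)
      (hmain.trans (ENNReal.ofReal_le_ofReal ?_)))
  -- the numerical bound
  set Q := Real.log n ^ (2 * (2 * θ.b + 1) / θ.b) with hQ
  have hQ1 : 1 ≤ Q := Real.one_le_rpow i8 (by positivity)
  set g := (n : ℝ) ^ (-γ) with hg
  have hg0 : 0 < g := by positivity
  have e1 : Real.exp (-(c₃ * (n - m - 1 : ℕ))) ≤ g := by
    refine le_trans (Real.exp_le_exp.2 (neg_le_neg (mul_le_mul_of_nonneg_left ?_ hc₃0.le))) i5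
    exact_mod_cast (by omega : N - 1 ≤ n - m - 1)
  have e2 : ((n - m : ℕ) : ℝ) ^ (-γ) ≤ 2 * g := by
    have h1 : (n : ℝ) / 2 ≤ ((n - m : ℕ) : ℝ) := by
      rw [div_le_iff₀ two_pos]
      exact_mod_cast (by omega : n ≤ (n - m) * 2)
    calc ((n - m : ℕ) : ℝ) ^ (-γ) ≤ ((n : ℝ) / 2) ^ (-γ) :=
          Real.rpow_le_rpow_of_nonpos (by positivity) h1 (by linarith)
      _ = 2 ^ γ * g := by
          rw [Real.div_rpow hn0.le zero_le_two, Real.rpow_neg zero_le_two, div_inv_eq_mul, mul_comm]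
      _ ≤ 2 ^ (1 : ℝ) * g := by
          gcongr
          · exact one_le_two
          · have : 0 < 1 / A := by positivity
            linarith
      _ = 2 * g := by rw [Real.rpow_one]
  have e3 : (n : ℝ) * ((n : ℝ) ^ s) ^ (1 - A) = g := by
    nth_rw 1 [← Real.rpow_one (n : ℝ)]
    rw [← Real.rpow_mul hn0.le, ← Real.rpow_add hn0, hsγ]
  have e4 : (m : ℝ) ≤ K * (2 * θ.A₀ * Q) := by
    rw [hm, Nat.cast_mul]; gcongr
  have t1 : K * (m : ℝ) * (D * Real.exp (-(c₃ * (n - m - 1 : ℕ))) +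
      K₁ * ((n - m : ℕ) : ℝ) ^ (-γ)) ≤ K * K * (2 * θ.A₀) * (D + 2 * K₁) * (Q * g) := by
    calc _ ≤ K * (K * (2 * θ.A₀ * Q)) * (D * g + K₁ * (2 * g)) := by gcongr
      _ = _ := by ring
  have t3 : K * (n : ℝ) * (c₂ / (A - 1) * ((n : ℝ) ^ s) ^ (1 - A)) = K * (c₂ / (A - 1)) * g := by
    rw [← e3]; ring
  have t4 : D * Real.exp (-(c₃ * (N - 1 : ℕ))) ≤ D * g := by gcongr
  have hgQ : g ≤ Q * g := le_mul_of_one_le_left hg0.le hQ1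
  have hcc : 0 ≤ 1 + K * (c₂ / (A - 1)) + D := by positivity
  have := mul_le_mul_of_nonneg_left hgQ hcc
  rw [t3]
  linarith

end ExtremeBandit

end

open ExtremeBandit
theorem theorem2 {K : ℕ} (α β C : Fin K → ℝ) (C' b : ℝ) (kstar : Fin K)
    (hα : ∀ k, 1 < α k) (hβ : ∀ k, 0 < β k) (hC : ∀ k, 0 < C k) (hC' : 0 < C')
    (hkstar : ∀ k, k ≠ kstar → α kstar < α k)
    (hb : 0 < b) (hbβ : ∀ k, b ≤ β k) :
    ∃ a₀ : ℝ, ∀ a ≥ a₀, ∃ D₀ E₀ : ℝ, ∀ D ≥ D₀, ∀ E ≥ E₀, ∀ A₀ > 0,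
      ∀ (alg : Algorithm) (L : ℝ), ∃ r : ℕ → ℝ,
        (∀ᶠ n : ℕ in atTop,
          ∀ (Ω : Type*) [MeasurableSpace Ω] (P : Measure Ω) [IsProbabilityMeasure P]
            (ν : Fin K → Measure ℝ) (X : Fin K → ℕ → Ω → ℝ) (I : ℕ → Ω → Fin K),
            (∀ k, IsSecondOrderPareto (α k) (β k) (C k) C' (ν k)) →
            (∀ k, Integrable (fun y : ℝ => y) (ν k)) →
            (∀ k, ∫ y, max (-y) 0 ∂(ν k) ≤ L) →
            IsRewardTable P ν X →
            (∀ t < n, Measurable (I t)) →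
            (∀ ω, IsRun alg
              { b := b, ρ := 2 * α kstar / (α kstar - 1), a := a, A₀ := A₀, D := D, E := E }
              n (fun k t => X k t ω) (fun t => I t ω)) →
            |expectedRegret P X n I| ≤ r n) ∧
        (r =O[atTop] fun n : ℕ =>
          Real.log n ^ (2 * (2 * b + 1) / b) * (n : ℝ) ^ (-(1 - 1 / α kstar)) +
            (n : ℝ) ^ (-(b - 1 / α kstar))) ∧
        (1 ≤ b → Tendsto r atTop (𝓝 0)) := by
  -- `52` comes from Lepski's comparison; for the widths nonnegativity is enough, since the indices
  -- only have to be right up to small powers of `n`.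
  refine ⟨52, fun a ha => ⟨0, 0, fun D hD E hE A₀ hA₀ alg L => ?_⟩⟩
  obtain ⟨c, hc⟩ := Tuning.exists_eventually_abs_expectedRegret_le (β := β)
    (θ := { b := b, ρ := 2 * α kstar / (α kstar - 1), a := a, A₀ := A₀, D := D, E := E })
    hα hC hC' hkstar hb hbβ rfl hA₀ hD hE ha alg L
  have hγ : 0 < 1 - 1 / α kstar := by
    have := (div_lt_one (by linarith [hα kstar])).2 (hα kstar)
    linarith
  refine ⟨_, hc, ?_, fun _ => ?_⟩
  -- The bound `r` is a multiple of the first summand; the second is nonnegative.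
  · refine IsBigO.const_mul_left (IsBigO.of_bound 1 ?_) c
    filter_upwards [eventually_ge_atTop 1] with n hn
    have hl : 0 ≤ Real.log n := Real.log_natCast_nonneg n
    rw [Real.norm_eq_abs, Real.norm_eq_abs, abs_of_nonneg (by positivity),
      abs_of_nonneg (by positivity), one_mul]
    have : 0 ≤ (n : ℝ) ^ (-(b - 1 / α kstar)) := by positivity
    linarith
  · have h1 := ((isLittleO_log_rpow_rpow_atTop (2 * (2 * b + 1) / b) hγ).comp_tendsto
      tendsto_natCast_atTop_atTop).tendsto_div_nhds_zero
    have h2 := h1.const_mul c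
    rw [mul_zero] at h2
    refine h2.congr fun n => ?_
    simp only [Function.comp_apply]
    rw [Real.rpow_neg (by positivity), div_eq_mul_inv]
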